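/- \textbf{Theorem.} The synthesis problem for the two-variable logic $\mathrm{FO}^2[\sim,<]$ with partitioned processes, $\mathrm{PartSynth}[\mathrm{FO}^2[\sim,<]]$, is undecidable. That is, no algorithm decides, given (an encoding of) a finite alphabet $A = A_S \uplus A_E$ and a sentence $\varphi$ of $\mathrm{FO}^2[\sim,<]$ over $A$, whether there are finite disjoint sets $P_S$ and $P_E$ (of any sizes) such that System has a winning strategy for $\varphi$. The notions are as follows. \emph{Data words.} Let $\Sigma_S = A_S\times P_S$, $\Sigma_E = A_E\times P_E$ and $\Sigma = \Sigma_S\cup\Sigma_E$. A data word is a finite or infinite sequence $w=\sigma_0\sigma_1\cdots$ over $\Sigma$. It is seen as a structure with one element for each position of $w$ and one element for each process in $P_S\cup P_E$. \emph{Logic.} Formulas of $\mathrm{FO}^2[\sim,<]$ are built with $\neg,\wedge,\vee,\exists,\forall$ and only two (reusable) variables from the atoms $a(z)$ for $a\in A$ ($z$ is a position with action $a$), $z=z'$, $z<z'$ (both are positions and $z$ is before $z'$), $z\sim z'$ ($z$ and $z'$ belong to the same process, where a position $(a,p)$ and the element $p$ belong to the process $p$), and $P_S(z)$, $P_E(z)$,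 $P_M(z)$ ($z$ is a process element of System, of Environment, shared; there are no shared processes here, so $P_M$ is empty). \emph{Game.} A strategy of System is a function $f:\Sigma^*\to\Sigma_S\cup\{\varepsilon\}$. A data word $w=\sigma_0\sigma_1\cdots$ is $f$-compatible if $\sigma_i = f(\sigma_0\cdots\sigma_{i-1})$ for every position $i$ with $\sigma_i\in\Sigma_S$, and, when $w$ is finite, $f(w)=\varepsilon$. It is fair for $f$ if, whenever $f(\sigma_0\cdots\sigma_{i-1})\neq\varepsilon$ for infinitely many positions $i$, there are infinitely many $i$ with $\sigma_i\in\Sigma_S$. The strategy $f$ is winning for $\varphi$ if every data word that is $f$-compatible and fair for $f$ satisfies $\varphi$. -/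

import Mathlib

namespace DataSynth

/-! ### Data words

`AS`, `AE` are the (disjoint) sets of actions of System and of Environment; `PS`, `PE`, `PM` are the
(disjoint) sets of processes owned by System, owned by Environment, and shared by both. -/

/-- The moves available to System: an action of System on a process that System may activate. -/
abbrev SysMove (AS PS PM : Type) : Type := AS × (PS ⊕ PM)

/-- The moves available to Environment. -/
abbrev EnvMove (AE PE PM : Type) : Type := AE × (PE ⊕ PM)

/-- The letters of data words: moves of System or of Environment. -/
abbrev Move (AS AE PS PE PM : Type) : Type := SysMove AS PS PM ⊕ EnvMove AE PE PM

/-- A data word: a finite or infinite sequence of moves. -/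
abbrev DataWord (AS AE PS PE PM : Type) : Type := Stream'.Seq (Move AS AE PS PE PM)

/-- All processes. -/
inductive Proc (PS PE PM : Type) : Type
  | sys (p : PS)
  | env (p : PE)
  | shared (p : PM)

section Semantics

variable {AS AE PS PE PM : Type}

/-- The action of a move. -/
def Move.action : Move AS AE PS PE PM → AS ⊕ AE
  | .inl (a, _) => .inl a
  | .inr (a, _) => .inr a

/-- The process on which a move is played. -/
def Move.proc : Move AS AE PS PE PM → Proc PS PE PM
  | .inl (_, .inl p) => .sys p
  | .inl (_, .inr p) => .shared p
  | .inr (_, .inl p) => .env p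
  | .inr (_, .inr p) => .shared p

/-- The domain of the structure of a data word: one element for each position of the word,
and one element for each process. -/
inductive Elem (w : DataWord AS AE PS PE PM) : Type
  | pos (i : ℕ) (m : Move AS AE PS PE PM) (h : w.get? i = some m)
  | proc (p : Proc PS PE PM)

namespace Elem

variable {w : DataWord AS AE PS PE PM}

/-- The process to which an element belongs (a process belongs to itself). -/
def owner : Elem w → Proc PS PE PM
  | .pos _ m _ => Move.proc m
  | .proc p => p

/-- The element is a position carrying action `a`. -/
def HasAction (a : AS ⊕ AE) : Elem w → Prop
  | .pos _ m _ => Move.action m = a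
  | .proc _ => False

/-- The linear order on positions (processes are not related by it). -/
def Lt : Elem w → Elem w → Prop
  | .pos i _ _, .pos j _ _ => i < j
  | _, _ => False

/-- The element is (the element of) a process of System. -/
def IsProcS (e : Elem w) : Prop := ∃ p : PS, e = .proc (.sys p)

/-- The element is (the element of) a process of Environment. -/
def IsProcE (e : Elem w) : Prop := ∃ p : PE, e = .proc (.env p)

/-- The element is (the element of) a shared process. -/
def IsProcM (e : Elem w) : Prop := ∃ p : PM, e = .proc (.shared p)

end Elem

end Semantics

/-! ### Two-variable first-order logic with `∼` and `<` -/

/-- Formulas of `FO²[∼,<]` over the actions `AS ⊕ AE`; the two variables are `0` and `1`. -/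
inductive Formula (AS AE : Type) : Type
  | act (a : AS ⊕ AE) (x : Fin 2)
  | eq (x y : Fin 2)
  | lt (x y : Fin 2)
  | sim (x y : Fin 2)
  | procS (x : Fin 2)
  | procE (x : Fin 2)
  | procM (x : Fin 2)
  | neg (φ : Formula AS AE)
  | conj (φ ψ : Formula AS AE)
  | disj (φ ψ : Formula AS AE)
  | ex (x : Fin 2) (φ : Formula AS AE)
  | all (x : Fin 2) (φ : Formula AS AE)

namespace Formula

variable {AS AE PS PE PM : Type}

/-- The free variables of a formula. -/
def freeVars : Formula AS AE → Set (Fin 2)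
  | act _ x => {x}
  | eq x y => {x, y}
  | lt x y => {x, y}
  | sim x y => {x, y}
  | procS x => {x}
  | procE x => {x}
  | procM x => {x}
  | neg φ => φ.freeVars
  | conj φ ψ => φ.freeVars ∪ ψ.freeVars
  | disj φ ψ => φ.freeVars ∪ ψ.freeVars
  | ex x φ => φ.freeVars \ {x}
  | all x φ => φ.freeVars \ {x}

/-- Satisfaction in the structure of `w` under a partial assignment `v` of the variables.
Assignments are partial only because the domain may be empty; atoms with an unassigned variable
(which are never met when a sentence is evaluated) count as false. -/
def Sat (w : DataWord AS AE PS PE PM) : (Fin 2 → Option (Elem w)) → Formula AS AE → Prop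
  | v, act a x => ∃ d, v x = some d ∧ d.HasAction a
  | v, eq x y => ∃ d e, v x = some d ∧ v y = some e ∧ d = e
  | v, lt x y => ∃ d e, v x = some d ∧ v y = some e ∧ d.Lt e
  | v, sim x y => ∃ d e, v x = some d ∧ v y = some e ∧ d.owner = e.owner
  | v, procS x => ∃ d, v x = some d ∧ d.IsProcS
  | v, procE x => ∃ d, v x = some d ∧ d.IsProcE
  | v, procM x => ∃ d, v x = some d ∧ d.IsProcM
  | v, neg φ => ¬ Sat w v φ
  | v, conj φ ψ => Sat w v φ ∧ Sat w v ψ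
  | v, disj φ ψ => Sat w v φ ∨ Sat w v ψ
  | v, ex x φ => ∃ d : Elem w, Sat w (Function.update v x (some d)) φ
  | v, all x φ => ∀ d : Elem w, Sat w (Function.update v x (some d)) φ

/-- A data word satisfies a sentence. -/
def Holds (w : DataWord AS AE PS PE PM) (φ : Formula AS AE) : Prop :=
  Sat w (fun _ => none) φ

end Formula

/-! ### The synthesis game -/

/-- A strategy of System: given the history, play a move of System or pass (`none`). -/
abbrev Strategy (AS AE PS PE PM : Type) : Type :=
  List (Move AS AE PS PE PM) → Option (SysMove AS PS PM)

namespace Strategy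

variable {AS AE PS PE PM : Type}

/-- `w` is compatible with the strategy: every move of System in `w` is the one prescribed by the
strategy, and if `w` is finite then the strategy passes after `w` (if `w` has ended before position
`i`, then `w.take i` is all of `w`). -/
def Compatible (σ : Strategy AS AE PS PE PM) (w : DataWord AS AE PS PE PM) : Prop :=
  (∀ (i : ℕ) (m : SysMove AS PS PM), w.get? i = some (.inl m) → σ (w.take i) = some m) ∧
  (∀ i : ℕ, w.TerminatedAt i → σ (w.take i) = none)

/-- `w` is fair for the strategy: if System wants to play infinitely often along `w`, then System
plays infinitely often in `w`. -/
def Fair (σ : Strategy AS AE PS PE PM) (w : DataWord AS AE PS PE PM) : Prop :=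
  {i : ℕ | ¬ w.TerminatedAt i ∧ σ (w.take i) ≠ none}.Infinite →
    {i : ℕ | ∃ m : SysMove AS PS PM, w.get? i = some (.inl m)}.Infinite

/-- The strategy is winning for the sentence `φ`. -/
def Winning (σ : Strategy AS AE PS PE PM) (φ : Formula AS AE) : Prop :=
  ∀ w : DataWord AS AE PS PE PM, σ.Compatible w → σ.Fair w → φ.Holds w

end Strategy

/-! ### The synthesis problem with partitioned processes -/

/-- Inputs of the problem: a finite alphabet, with `numSys` actions of System and `numEnv` actions
of Environment, and a sentence of `FO²[∼,<]` over this alphabet. -/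
structure Input : Type where
  numSys : ℕ
  numEnv : ℕ
  formula : Formula (Fin numSys) (Fin numEnv)
  closed : formula.freeVars = ∅

/-- The input is a positive instance of the synthesis problem with partitioned processes: for some
finite numbers of processes of System and of Environment, and no shared process, System has a
winning strategy. -/
def Input.PartSynth (I : Input) : Prop :=
  ∃ nS nE : ℕ, ∃ σ : Strategy (Fin I.numSys) (Fin I.numEnv) (Fin nS) (Fin nE) Empty,
    σ.Winning I.formula

/-! ### Inputs as natural numbers -/

/-- The number of an action. -/
def letterCode {m n : ℕ} : Fin m ⊕ Fin n → ℕ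
  | .inl k => Nat.pair 0 k
  | .inr k => Nat.pair 1 k

/-- The number of a formula: the syntax tree, coded by means of a pairing function. -/
def Formula.code {m n : ℕ} : Formula (Fin m) (Fin n) → ℕ
  | .act a x => Nat.pair 0 (Nat.pair (letterCode a) x)
  | .eq x y => Nat.pair 1 (Nat.pair x y)
  | .lt x y => Nat.pair 2 (Nat.pair x y)
  | .sim x y => Nat.pair 3 (Nat.pair x y)
  | .procS x => Nat.pair 4 x
  | .procE x => Nat.pair 5 x
  | .procM x => Nat.pair 6 x
  | .neg φ => Nat.pair 7 φ.code
  | .conj φ ψ => Nat.pair 8 (Nat.pair φ.code ψ.code)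
  | .disj φ ψ => Nat.pair 9 (Nat.pair φ.code ψ.code)
  | .ex x φ => Nat.pair 10 (Nat.pair x φ.code)
  | .all x φ => Nat.pair 11 (Nat.pair x φ.code)

/-- The number of an input. -/
def Input.code (I : Input) : ℕ :=
  Nat.pair I.numSys (Nat.pair I.numEnv I.formula.code)

theorem letterCode_injective {m n : ℕ} :
    Function.Injective (letterCode : Fin m ⊕ Fin n → ℕ) := by
  rintro (a | a) (b | b) h <;> simp_all [letterCode, Nat.pair_eq_pair, Fin.ext_iff]

theorem Formula.code_injective {m n : ℕ} :
    Function.Injective (Formula.code : Formula (Fin m) (Fin n) → ℕ) := by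
  intro φ
  induction φ with
  | act a x =>
    intro ψ h
    cases ψ <;> simp [code, Nat.pair_eq_pair, Fin.val_inj] at h ⊢
    exact ⟨letterCode_injective h.1, h.2⟩
  | neg φ ih =>
    intro ψ h
    cases ψ <;> simp [code, Nat.pair_eq_pair] at h ⊢
    exact ih h
  | conj φ φ' ih ih' =>
    intro ψ h
    cases ψ <;> simp [code, Nat.pair_eq_pair] at h ⊢
    exact ⟨ih h.1, ih' h.2⟩
  | disj φ φ' ih ih' =>
    intro ψ h
    cases ψ <;> simp [code, Nat.pair_eq_pair] at h ⊢
    exact ⟨ih h.1, ih' h.2⟩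
  | ex x φ ih =>
    intro ψ h
    cases ψ <;> simp [code, Nat.pair_eq_pair, Fin.val_inj] at h ⊢
    exact ⟨h.1, ih h.2⟩
  | all x φ ih =>
    intro ψ h
    cases ψ <;> simp [code, Nat.pair_eq_pair, Fin.val_inj] at h ⊢
    exact ⟨h.1, ih h.2⟩
  | _ =>
    intro ψ h
    cases ψ <;> simp_all [code, Nat.pair_eq_pair, Fin.val_inj]

/-- Different inputs have different numbers. -/
theorem Input.code_injective : Function.Injective Input.code := by
  rintro ⟨m, n, φ, hφ⟩ ⟨m', n', ψ, hψ⟩ h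
  simp only [Input.code, Nat.pair_eq_pair] at h
  obtain ⟨rfl, rfl, h⟩ := h
  obtain rfl := Formula.code_injective h
  rfl

end DataSynth

/-! The halting problem reduces to synthesis by way of machines with several stacks. System, playing
alone, writes a run: each move is a transition, and a pushed symbol is identified with the fresh
System process on which the push is played; reading or removing the symbol is a later move on the
same process. Finiteness of the set of processes only bounds the length of the run, and the bound is
for System to choose.

That a symbol being read is on top of its stack relates three positions: the read, its push, and any
later push on that stack, which must have been removed before the read. With two variables this is
expressed for the last event only, where "removed before" becomes "removed somewhere in the word".
The game supplies all the other times: Environment has a single action, and once it is used System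
must stop and the moves so far must satisfy `Correct`. The strategy cannot foresee the interruption,
so every prefix of its solitary play must be correct, and the play is a genuine run
(`Represents.rel_of_correct`, `exists_run_of_goal`). Conversely, a finite run yields a strategy that
plays it out and passes after an interruption (`exists_goal_of_run`). The sentence also demands a
process of Environment, lest System remove the threat by choosing none.

Without interruption, the run must contain a halting transition and the transition `g` at time `N`.
The machine `simMachine` loads an arbitrary unary number, fires `go`, and then simulates a `TM2`
evaluator of partial recursive functions; the time of `go` reveals the number loaded. Hence the
input enters the sentence only through `atTime g N`, and the reduction is computable
(`exists_input`, `exists_input_of_partrec`). -/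

namespace DataSynth

open Function

/-! ### Events of System and definability -/

section Definability

variable {AS AE : Type}

/-- The moves of System on its own processes in a data word, as triples of a position, an action
and a process. -/
def DataWord.events {AS AE PS PE PM : Type} (w : DataWord AS AE PS PE PM) : Set (ℕ × AS × PS) :=
  {x | w.get? x.1 = some (.inl (x.2.1, .inl x.2.2))}

theorem DataWord.mem_events {AS AE PS PE PM : Type} {w : DataWord AS AE PS PE PM}
    {x : ℕ × AS × PS} : x ∈ w.events ↔ w.get? x.1 = some (.inl (x.2.1, .inl x.2.2)) := Iff.rfl

/-- The position of an event, as an element of the structure. -/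
def evElem {AS AE PS PE PM : Type} {w : DataWord AS AE PS PE PM} (x : w.events) : Elem w :=
  .pos x.1.1 _ x.2

/-- A property of data words is definable by a sentence. -/
def Def0 (R : ∀ {PS PE : Type}, DataWord AS AE PS PE Empty → Prop) : Prop :=
  ∃ φ : Formula AS AE, ∀ {PS PE : Type} (w : DataWord AS AE PS PE Empty)
    (v : Fin 2 → Option (Elem w)), φ.Sat w v ↔ R w

/-- A property of events is definable. -/
def Def1 (R : ∀ {PS PE : Type} (_w : DataWord AS AE PS PE Empty), ℕ × AS × PS → Prop) : Prop :=
  ∃ φ : Formula AS AE, ∀ {PS PE : Type} (w : DataWord AS AE PS PE Empty)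
    (v : Fin 2 → Option (Elem w)) (x : w.events), v 0 = some (evElem x) → (φ.Sat w v ↔ R w x)

/-- A binary relation between events is definable. -/
def Def2 (R : ∀ {PS PE : Type} (_w : DataWord AS AE PS PE Empty),
    ℕ × AS × PS → ℕ × AS × PS → Prop) : Prop :=
  ∃ φ : Formula AS AE, ∀ {PS PE : Type} (w : DataWord AS AE PS PE Empty)
    (v : Fin 2 → Option (Elem w)) (x y : w.events), v 0 = some (evElem x) →
      v 1 = some (evElem y) → (φ.Sat w v ↔ R w x y)

/-- Exchange of the two variables. -/
def Formula.swap : Formula AS AE → Formula AS AE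
  | act a x => act a (1 - x)
  | eq x y => eq (1 - x) (1 - y)
  | lt x y => lt (1 - x) (1 - y)
  | sim x y => sim (1 - x) (1 - y)
  | procS x => procS (1 - x)
  | procE x => procE (1 - x)
  | procM x => procM (1 - x)
  | neg φ => neg φ.swap
  | conj φ ψ => conj φ.swap ψ.swap
  | disj φ ψ => disj φ.swap ψ.swap
  | ex x φ => ex (1 - x) φ.swap
  | all x φ => all (1 - x) φ.swap

theorem update_swap {α : Type} (v : Fin 2 → α) (x : Fin 2) (d : α) :
    (fun z => update v (1 - x) d (1 - z)) = update (fun z => v (1 - z)) x d := by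
  funext z
  fin_cases x <;> fin_cases z <;> simp [update]

/-- What has been defined for the event at one variable can thereby be used at the other, as nesting
quantifiers with two variables requires. -/
theorem Formula.sat_swap {PS PE PM : Type} {w : DataWord AS AE PS PE PM} (φ : Formula AS AE)
    (v : Fin 2 → Option (Elem w)) : φ.swap.Sat w v ↔ φ.Sat w (fun z => v (1 - z)) := by
  induction φ generalizing v with
  | ex x φ ih => simp only [swap, Sat, ih, update_swap]
  | all x φ ih => simp only [swap, Sat, ih, update_swap]
  | neg φ ih => simp only [swap, Sat, ih]
  | conj φ ψ ih ih' => simp only [swap, Sat, ih, ih']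
  | disj φ ψ ih ih' => simp only [swap, Sat, ih, ih']
  | _ => simp [swap, Sat]

/-- The disjunction of a list of formulas; the unsatisfiable formula if the list is empty. -/
def Formula.bigDisj : List (Formula AS AE) → Formula AS AE
  | [] => ex 0 (neg (eq 0 0))
  | φ :: l => disj φ (bigDisj l)

theorem Formula.sat_bigDisj {PS PE PM : Type} {w : DataWord AS AE PS PE PM}
    (l : List (Formula AS AE)) (v : Fin 2 → Option (Elem w)) :
    (bigDisj l).Sat w v ↔ ∃ φ ∈ l, φ.Sat w v := by
  induction l with
  | nil => simp [bigDisj, Sat]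
  | cons φ l ih => simp [bigDisj, Sat, ih]

theorem exists_evElem {PS PE : Type} {w : DataWord AS AE PS PE Empty} {e : Elem w} {t : AS}
    (h : e.HasAction (.inl t)) : ∃ x : w.events, evElem x = e ∧ x.1.2.1 = t := by
  cases e with
  | proc => exact h.elim
  | pos i m hm =>
    obtain ⟨s, p | p⟩ | ⟨s, p⟩ := m
    · exact ⟨⟨(i, s, p), hm⟩, rfl, Sum.inl.inj h⟩
    · exact p.elim
    · cases h

theorem evElem_hasAction {PS PE : Type} {w : DataWord AS AE PS PE Empty} (x : w.events) (t : AS) :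
    (evElem x).HasAction (.inl t) ↔ x.1.2.1 = t := by
  simp [evElem, Elem.HasAction, Move.action]

theorem Def2.swap {R : ∀ {PS PE : Type} (_w : DataWord AS AE PS PE Empty),
    ℕ × AS × PS → ℕ × AS × PS → Prop} (h : Def2 R) : Def2 (fun w x y => R w y x) := by
  obtain ⟨φ, h⟩ := h
  exact ⟨φ.swap, fun w v x y hx hy => (φ.sat_swap v).trans (h w _ y x hy hx)⟩

theorem Def1.left {R : ∀ {PS PE : Type} (_w : DataWord AS AE PS PE Empty),
    ℕ × AS × PS → Prop} (h : Def1 R) : Def2 (fun w x _ => R w x) := by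
  obtain ⟨φ, h⟩ := h
  exact ⟨φ, fun w v x y hx _ => h w v x hx⟩

theorem Def1.right {R : ∀ {PS PE : Type} (_w : DataWord AS AE PS PE Empty),
    ℕ × AS × PS → Prop} (h : Def1 R) : Def2 (fun w _ y => R w y) :=
  (Def1.left h).swap

theorem Def2.not {R : ∀ {PS PE : Type} (_w : DataWord AS AE PS PE Empty),
    ℕ × AS × PS → ℕ × AS × PS → Prop} (h : Def2 R) : Def2 (fun w x y => ¬ R w x y) := by
  obtain ⟨φ, h⟩ := h
  exact ⟨.neg φ, fun w v x y hx hy => not_congr (h w v x y hx hy)⟩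

theorem Def2.and {R S : ∀ {PS PE : Type} (_w : DataWord AS AE PS PE Empty),
    ℕ × AS × PS → ℕ × AS × PS → Prop} (h : Def2 R) (h' : Def2 S) :
    Def2 (fun w x y => R w x y ∧ S w x y) := by
  obtain ⟨φ, h⟩ := h
  obtain ⟨ψ, h'⟩ := h'
  exact ⟨.conj φ ψ, fun w v x y hx hy => and_congr (h w v x y hx hy) (h' w v x y hx hy)⟩

theorem Def2.imp {R S : ∀ {PS PE : Type} (_w : DataWord AS AE PS PE Empty),
    ℕ × AS × PS → ℕ × AS × PS → Prop} (h : Def2 R) (h' : Def2 S) :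
    Def2 (fun w x y => R w x y → S w x y) := by
  obtain ⟨φ, h⟩ := h
  obtain ⟨ψ, h'⟩ := h'
  exact ⟨.disj (.neg φ) ψ, fun w v x y hx hy => by
    simp only [Formula.Sat, h w v x y hx hy, h' w v x y hx hy, imp_iff_not_or]⟩

theorem Def1.not {R : ∀ {PS PE : Type} (_w : DataWord AS AE PS PE Empty),
    ℕ × AS × PS → Prop} (h : Def1 R) : Def1 (fun w x => ¬ R w x) := by
  obtain ⟨φ, h⟩ := h
  exact ⟨.neg φ, fun w v x hx => not_congr (h w v x hx)⟩

theorem Def1.and {R S : ∀ {PS PE : Type} (_w : DataWord AS AE PS PE Empty),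
    ℕ × AS × PS → Prop} (h : Def1 R) (h' : Def1 S) : Def1 (fun w x => R w x ∧ S w x) := by
  obtain ⟨φ, h⟩ := h
  obtain ⟨ψ, h'⟩ := h'
  exact ⟨.conj φ ψ, fun w v x hx => and_congr (h w v x hx) (h' w v x hx)⟩

theorem Def1.imp {R S : ∀ {PS PE : Type} (_w : DataWord AS AE PS PE Empty),
    ℕ × AS × PS → Prop} (h : Def1 R) (h' : Def1 S) : Def1 (fun w x => R w x → S w x) := by
  obtain ⟨φ, h⟩ := h
  obtain ⟨ψ, h'⟩ := h'
  exact ⟨.disj (.neg φ) ψ, fun w v x hx => by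
    simp only [Formula.Sat, h w v x hx, h' w v x hx, imp_iff_not_or]⟩

theorem Def0.not {R : ∀ {PS PE : Type}, DataWord AS AE PS PE Empty → Prop} (h : Def0 R) :
    Def0 (fun w => ¬ R w) := by
  obtain ⟨φ, h⟩ := h
  exact ⟨.neg φ, fun w v => not_congr (h w v)⟩

theorem Def0.and {R S : ∀ {PS PE : Type}, DataWord AS AE PS PE Empty → Prop} (h : Def0 R)
    (h' : Def0 S) : Def0 (fun w => R w ∧ S w) := by
  obtain ⟨φ, h⟩ := h
  obtain ⟨ψ, h'⟩ := h'
  exact ⟨.conj φ ψ, fun w v => and_congr (h w v) (h' w v)⟩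

theorem Def0.imp {R S : ∀ {PS PE : Type}, DataWord AS AE PS PE Empty → Prop} (h : Def0 R)
    (h' : Def0 S) : Def0 (fun w => R w → S w) := by
  obtain ⟨φ, h⟩ := h
  obtain ⟨ψ, h'⟩ := h'
  exact ⟨.disj (.neg φ) ψ, fun w v => by simp only [Formula.Sat, h w v, h' w v, imp_iff_not_or]⟩

/-! ### Basic definable relations and bounded quantification -/

theorem def2_lt : Def2 (AS := AS) (AE := AE) (fun _ x y => x.1 < y.1) :=
  ⟨.lt 0 1, fun w v x y hx hy => by simp [Formula.Sat, hx, hy, evElem, Elem.Lt]⟩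

theorem def2_sim : Def2 (AS := AS) (AE := AE) (fun _ x y => x.2.2 = y.2.2) :=
  ⟨.sim 0 1, fun w v x y hx hy => by
    simp [Formula.Sat, hx, hy, evElem, Elem.owner, Move.proc]⟩

/-- The alphabet is finite, so any relation between actions, however specified, is a finite
disjunction of pairs of atoms. -/
theorem def2_action [Finite AS] (R : AS → AS → Prop) :
    Def2 (AS := AS) (AE := AE) (fun _ x y => R x.2.1 y.2.1) := by
  classical
  have := Fintype.ofFinite AS
  refine ⟨.bigDisj ((Finset.univ.filter fun a : AS × AS => R a.1 a.2).toList.map fun a =>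
    .conj (.act (.inl a.1) 0) (.act (.inl a.2) 1)), fun w v x y hx hy => ?_⟩
  simp only [Formula.sat_bigDisj, List.mem_map, Finset.mem_toList, Finset.mem_filter,
    Finset.mem_univ, true_and]
  constructor
  · rintro ⟨_, ⟨a, ha, rfl⟩, ⟨d, hd, h⟩, ⟨e, he, h'⟩⟩
    rw [hx, Option.some_inj] at hd
    rw [hy, Option.some_inj] at he
    subst hd he
    rw [evElem_hasAction] at h h'
    rwa [h, h']
  · exact fun h => ⟨_, ⟨(x.1.2.1, y.1.2.1), h, rfl⟩, ⟨_, hx, (evElem_hasAction _ _).2 rfl⟩,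
      ⟨_, hy, (evElem_hasAction _ _).2 rfl⟩⟩

theorem def1_action [Finite AS] (R : AS → Prop) :
    Def1 (AS := AS) (AE := AE) (fun _ x => R x.2.1) := by
  classical
  have := Fintype.ofFinite AS
  refine ⟨.bigDisj ((Finset.univ.filter fun a : AS => R a).toList.map fun a =>
    .act (.inl a) 0), fun w v x hx => ?_⟩
  simp only [Formula.sat_bigDisj, List.mem_map, Finset.mem_toList, Finset.mem_filter,
    Finset.mem_univ, true_and]
  constructor
  · rintro ⟨_, ⟨a, ha, rfl⟩, ⟨d, hd, h⟩⟩
    rw [hx, Option.some_inj] at hd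
    subst hd
    rw [evElem_hasAction] at h
    rwa [h]
  · exact fun h => ⟨_, ⟨x.1.2.1, h, rfl⟩, ⟨_, hx, (evElem_hasAction _ _).2 rfl⟩⟩

/-- The formula expressing that variable `x` denotes an event of System. -/
noncomputable def Formula.isSys [Fintype AS] (x : Fin 2) : Formula AS AE :=
  .bigDisj ((Finset.univ : Finset AS).toList.map fun a => .act (.inl a) x)

theorem Formula.sat_isSys [Fintype AS] {PS PE : Type} {w : DataWord AS AE PS PE Empty}
    (x : Fin 2) (v : Fin 2 → Option (Elem w)) :
    (Formula.isSys x).Sat w v ↔ ∃ e : w.events, v x = some (evElem e) := by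
  simp only [isSys, Formula.sat_bigDisj, List.mem_map, Finset.mem_toList, Finset.mem_univ, true_and]
  constructor
  · rintro ⟨_, ⟨a, rfl⟩, d, hd, h⟩
    obtain ⟨e, rfl, -⟩ := exists_evElem h
    exact ⟨e, hd⟩
  · rintro ⟨e, he⟩
    exact ⟨_, ⟨e.1.2.1, rfl⟩, _, he, (evElem_hasAction _ _).2 rfl⟩

/-- Variable `1` is released here and can be bound again, which is how clauses of greater quantifier
depth stay within two variables. The guard `isSys` removes processes and moves of Environment from
the range. -/
theorem Def2.exists [Finite AS] {R : ∀ {PS PE : Type} (_w : DataWord AS AE PS PE Empty),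
    ℕ × AS × PS → ℕ × AS × PS → Prop} (h : Def2 R) :
    Def1 (fun w x => ∃ y ∈ w.events, R w x y) := by
  have := Fintype.ofFinite AS
  obtain ⟨φ, h⟩ := h
  refine ⟨.ex 1 (.conj (.isSys 1) φ), fun w v x hx => ?_⟩
  simp only [Formula.Sat, Formula.sat_isSys, update_self]
  constructor
  · rintro ⟨d, ⟨e, he⟩, hd⟩
    exact ⟨e, e.2, (h w _ x e (by simpa [update]) (by simpa using he)).1 hd⟩
  · rintro ⟨y, hy, hR⟩
    exact ⟨evElem ⟨y, hy⟩, ⟨_, rfl⟩, (h w _ x ⟨y, hy⟩ (by simpa [update]) (by simp)).2 hR⟩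

theorem Def1.exists [Finite AS] {R : ∀ {PS PE : Type} (_w : DataWord AS AE PS PE Empty),
    ℕ × AS × PS → Prop} (h : Def1 R) : Def0 (fun w => ∃ x ∈ w.events, R w x) := by
  have := Fintype.ofFinite AS
  obtain ⟨φ, h⟩ := h
  refine ⟨.ex 0 (.conj (.isSys 0) φ), fun w v => ?_⟩
  simp only [Formula.Sat, Formula.sat_isSys, update_self]
  constructor
  · rintro ⟨d, ⟨e, he⟩, hd⟩
    exact ⟨e, e.2, (h w _ e (by simpa using he)).1 hd⟩
  · rintro ⟨y, hy, hR⟩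
    exact ⟨evElem ⟨y, hy⟩, ⟨_, rfl⟩, (h w _ ⟨y, hy⟩ (by simp)).2 hR⟩

theorem Def2.forall [Finite AS] {R : ∀ {PS PE : Type} (_w : DataWord AS AE PS PE Empty),
    ℕ × AS × PS → ℕ × AS × PS → Prop} (h : Def2 R) :
    Def1 (fun w x => ∀ y ∈ w.events, R w x y) := by
  simpa using h.not.exists.not

theorem Def1.forall [Finite AS] {R : ∀ {PS PE : Type} (_w : DataWord AS AE PS PE Empty),
    ℕ × AS × PS → Prop} (h : Def1 R) : Def0 (fun w => ∀ x ∈ w.events, R w x) := by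
  simpa using h.not.exists.not

/-- Some position carries a move of Environment. -/
def DataWord.HasEnv {AS AE PS PE PM : Type} (w : DataWord AS AE PS PE PM) : Prop :=
  ∃ i m, w.get? i = some (.inr m)

/-- No move of System follows a move of Environment. -/
def DataWord.SysFirst {AS AE PS PE PM : Type} (w : DataWord AS AE PS PE PM) : Prop :=
  ∀ i m j m', w.get? i = some (.inr m) → w.get? j = some (.inl m') → j ≤ i

/-- The formula expressing that variable `x` denotes a move of Environment. -/
def Formula.isEnv (x : Fin 2) : Formula AS (Fin 1) := .act (.inr 0) x

theorem def0_hasEnv : Def0 (AS := AS) (AE := Fin 1) (fun w => w.HasEnv) := by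
  refine ⟨.ex 0 (.isEnv 0), fun w v => ?_⟩
  simp only [Formula.Sat, Formula.isEnv, update_self]
  constructor
  · rintro ⟨_, d, hd', hd⟩
    obtain ⟨i, _ | m, hm⟩ | _ := d
    · cases hd
    · exact ⟨i, m, hm⟩
    · exact hd.elim
  · rintro ⟨i, m, hm⟩
    exact ⟨.pos i _ hm, _, rfl, congrArg Sum.inr (Subsingleton.elim _ _)⟩

theorem def0_sysFirst [Finite AS] : Def0 (AS := AS) (AE := Fin 1) (fun w => w.SysFirst) := by
  have := Fintype.ofFinite AS
  refine ⟨.neg (.ex 0 (.ex 1 (.conj (.isEnv 0) (.conj (.isSys 1) (.lt 0 1))))), fun w v => ?_⟩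
  simp only [Formula.Sat, Formula.sat_isSys, Formula.isEnv, update_self, DataWord.SysFirst]
  rw [not_iff_comm]
  push Not
  constructor
  · rintro ⟨i, m, j, ⟨a, p | p⟩, hi, hj, hij⟩
    · refine ⟨.pos i _ hi, evElem ⟨(j, a, p), hj⟩, ?_⟩
      simp [update, Elem.HasAction, Move.action, evElem, Elem.Lt, hij, Subsingleton.elim m.1 0]
      exact ⟨j, a, p, hj, rfl⟩
    · exact p.elim
  · rintro ⟨d, e, hd, ⟨y, hy⟩, hlt⟩
    simp only [update, Fin.isValue, zero_ne_one, ↓reduceDIte, Option.some.injEq, exists_eq_left',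
      ] at hd hlt hy
    subst hy
    obtain ⟨i, _ | m, hm⟩ | _ := d
    · cases hd
    · exact ⟨i, m, _, _, hm, y.2, by simpa [evElem, Elem.Lt] using hlt⟩
    · exact hd.elim

/-- There is a process of Environment. -/
theorem def0_procE : Def0 (AS := AS) (AE := AE) (fun {_ PE} _ => Nonempty PE) := by
  refine ⟨.ex 0 (.procE 0), fun w v => ?_⟩
  simp only [Formula.Sat, update_self]
  constructor
  · rintro ⟨_, d, -, p, hd⟩
    exact ⟨p⟩
  · rintro ⟨p⟩
    exact ⟨.proc (.env p), _, rfl, p, rfl⟩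

end Definability

/-! ### Multi-stack machines and their traces -/

/-- The elementary operations on stacks: push a symbol, look at the top symbol (and remove it if the
flag is `true`), test for emptiness, and do nothing. -/
inductive StackOp (K Γ : Type) : Type
  | push (k : K) (a : Γ)
  | look (k : K) (a : Γ) (b : Bool)
  | empty (k : K)
  | nop

/-- A nondeterministic multi-stack machine with set of transitions `T`. -/
structure StackMachine (T K Γ Q : Type) : Type where
  src : T → Q
  dst : T → Q
  op : T → StackOp K Γ
  start : Q

/-- The effect of an operation on the stacks. -/
def StackOp.Rel {K Γ : Type} [DecidableEq K] (S S' : K → List Γ) : StackOp K Γ → Prop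
  | push k a => S' = update S k (a :: S k)
  | look k a b => ∃ l, S k = a :: l ∧ S' = if b then update S k l else S
  | empty k => S k = [] ∧ S' = S
  | nop => S' = S

/-- Nondeterminism lies only in the choice of the transition. This identifies the stacks of a given
run with those recovered from its trace. -/
theorem StackOp.Rel.unique {K Γ : Type} [DecidableEq K] {S S₁ S₂ : K → List Γ} {o : StackOp K Γ}
    (h₁ : o.Rel S S₁) (h₂ : o.Rel S S₂) : S₁ = S₂ := by
  cases o with
  | push => exact h₁.trans h₂.symm
  | look k a b =>
    obtain ⟨l, hl, rfl⟩ := h₁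
    obtain ⟨l', hl', rfl⟩ := h₂
    rw [hl] at hl'
    cases hl'
    rfl
  | empty => exact h₁.2.trans h₂.2.symm
  | nop => exact h₁.trans h₂.symm

namespace StackMachine

variable {T K Γ Q P : Type} (M : StackMachine T K Γ Q)

/-- The transition reads a stack symbol. -/
def IsLook (t : T) : Prop := ∃ k a b, M.op t = .look k a b

/-- The transition removes a stack symbol. -/
def IsPop (t : T) : Prop := ∃ k a, M.op t = .look k a true

/-- `t` reads the symbol pushed by `t'`. -/
def Reads (t t' : T) : Prop := ∃ k a b, M.op t = .look k a b ∧ M.op t' = .push k a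

/-- `t` and `t'` push on the same stack. -/
def PushSame (t t' : T) : Prop := ∃ k a a', M.op t = .push k a ∧ M.op t' = .push k a'

/-- `t` tests the stack on which `t'` pushes for emptiness. -/
def TestsPush (t t' : T) : Prop := ∃ k a, M.op t = .empty k ∧ M.op t' = .push k a

/-- The event `x` is the last one. -/
def Last (E : Set (ℕ × T × P)) (x : ℕ × T × P) : Prop := ∀ y ∈ E, ¬ x.1 < y.1

/-- The event `y` is the last but one. -/
def BeforeLast (E : Set (ℕ × T × P)) (y : ℕ × T × P) : Prop :=
  ¬ Last E y ∧ ∀ x ∈ E, y.1 < x.1 → Last E x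

/-- The symbol pushed on process `p` has been removed. -/
def Dead (E : Set (ℕ × T × P)) (p : P) : Prop := ∃ x ∈ E, x.2.2 = p ∧ M.IsPop x.2.1

/-- The last event of a set of events is a correct move of the machine. A symbol on a stack is
represented by the process on which it has been pushed. -/
structure Correct (E : Set (ℕ × T × P)) : Prop where
  first : ∀ x ∈ E, (¬ ∃ y ∈ E, y.1 < x.1) → M.src x.2.1 = M.start
  fresh : ∀ x ∈ E, ∀ y ∈ E, y.1 < x.1 → y.2.2 = x.2.2 → M.IsLook x.2.1
  reads : ∀ x ∈ E, M.IsLook x.2.1 →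
    ∃ y ∈ E, y.1 < x.1 ∧ y.2.2 = x.2.2 ∧ M.Reads x.2.1 y.2.1
  live : ∀ x ∈ E, ∀ y ∈ E, y.1 < x.1 → y.2.2 = x.2.2 → ¬ M.IsPop y.2.1
  next : ∀ x ∈ E, Last E x → ∀ y ∈ E, BeforeLast E y → M.dst y.2.1 = M.src x.2.1
  top : ∀ z ∈ E, (∃ x ∈ E, x.2.2 = z.2.2 ∧ Last E x ∧ M.IsLook x.2.1) →
    ∀ y ∈ E, z.1 < y.1 → M.PushSame z.2.1 y.2.1 → M.Dead E y.2.2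
  empty : ∀ x ∈ E, Last E x → ∀ y ∈ E, M.TestsPush x.2.1 y.2.1 → M.Dead E y.2.2

/-- Being last, last but one, or dead are properties of a single event, defined by reusing the other
variable, so each clause compares only two events at a time. In `top` the last event is quantified
away inside a property of the push `z`, which leaves a variable for the later push `y`. -/
theorem def0_correct [Finite T] : Def0 (AE := Fin 1) (fun w => M.Correct w.events) := by
  have hlast : Def1 (AS := T) (AE := Fin 1) (fun w x => Last w.events x) := def2_lt.not.forall
  have hbefore : Def1 (AS := T) (AE := Fin 1) (fun w x => BeforeLast w.events x) :=
    hlast.not.and (def2_lt.imp hlast.right).forall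
  have hdead : Def1 (AS := T) (AE := Fin 1) (fun w y => M.Dead w.events y.2.2) :=
    (def2_sim.swap.and (def1_action fun t => M.IsPop t).right).exists
  have hlook : Def1 (AS := T) (AE := Fin 1) (fun w x => M.IsLook x.2.1) := def1_action _
  have hgt : Def2 (AS := T) (AE := Fin 1) (fun w x y => y.1 < x.1) := def2_lt.swap
  have hsim : Def2 (AS := T) (AE := Fin 1) (fun w x y => y.2.2 = x.2.2) := def2_sim.swap
  have h1 : Def0 (AS := T) (AE := Fin 1) (fun w => ∀ x ∈ w.events,
      (¬ ∃ y ∈ w.events, y.1 < x.1) → M.src x.2.1 = M.start) :=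
    (hgt.exists.not.imp (def1_action fun t => M.src t = M.start)).forall
  have h2 : Def0 (AS := T) (AE := Fin 1) (fun w => ∀ x ∈ w.events, ∀ y ∈ w.events,
      y.1 < x.1 → y.2.2 = x.2.2 → M.IsLook x.2.1) :=
    (hgt.imp (hsim.imp hlook.left)).forall.forall
  have h3 : Def0 (AS := T) (AE := Fin 1) (fun w => ∀ x ∈ w.events, M.IsLook x.2.1 →
      ∃ y ∈ w.events, y.1 < x.1 ∧ y.2.2 = x.2.2 ∧ M.Reads x.2.1 y.2.1) :=
    (hlook.imp (hgt.and (hsim.and (def2_action M.Reads))).exists).forall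
  have h4 : Def0 (AS := T) (AE := Fin 1) (fun w => ∀ x ∈ w.events, ∀ y ∈ w.events,
      y.1 < x.1 → y.2.2 = x.2.2 → ¬ M.IsPop y.2.1) :=
    (hgt.imp (hsim.imp (def1_action fun t => M.IsPop t).not.right)).forall.forall
  have h5 : Def0 (AS := T) (AE := Fin 1) (fun w => ∀ x ∈ w.events, Last w.events x →
      ∀ y ∈ w.events, BeforeLast w.events y → M.dst y.2.1 = M.src x.2.1) :=
    (hlast.imp (hbefore.right.imp (def2_action fun t t' => M.dst t' = M.src t)).forall).forall
  have h6 : Def0 (AS := T) (AE := Fin 1) (fun w => ∀ z ∈ w.events,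
      (∃ x ∈ w.events, x.2.2 = z.2.2 ∧ Last w.events x ∧ M.IsLook x.2.1) →
      ∀ y ∈ w.events, z.1 < y.1 → M.PushSame z.2.1 y.2.1 → M.Dead w.events y.2.2) :=
    ((hsim.and (hlast.and hlook).right).exists.imp
      (def2_lt.imp ((def2_action M.PushSame).imp hdead.right)).forall).forall
  have h7 : Def0 (AS := T) (AE := Fin 1) (fun w => ∀ x ∈ w.events, Last w.events x →
      ∀ y ∈ w.events, M.TestsPush x.2.1 y.2.1 → M.Dead w.events y.2.2) :=
    (hlast.imp ((def2_action M.TestsPush).imp hdead.right).forall).forall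
  obtain ⟨φ, hφ⟩ := h1.and (h2.and (h3.and (h4.and (h5.and (h6.and h7)))))
  refine ⟨φ, fun w v => (hφ w v).trans ⟨fun ⟨a, b, c, d, e, f, g⟩ => ⟨a, b, c, d, e, f, g⟩,
    fun ⟨a, b, c, d, e, f, g⟩ => ⟨a, b, c, d, e, f, g⟩⟩⟩

/-- The set of events of a list of transitions on processes. -/
def listEvents (u : List (T × P)) : Set (ℕ × T × P) := {x | u[x.1]? = some x.2}

theorem listEvents_concat (u : List (T × P)) (a : T × P) :
    listEvents (u ++ [a]) = insert (u.length, a) (listEvents u) := by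
  ext ⟨i, b⟩
  simp only [listEvents, Set.mem_ofPred_eq, Set.mem_insert_iff, Prod.mk.injEq,
    List.getElem?_append]
  split_ifs with h
  · simp [h.ne]
  · rcases (not_lt.1 h).eq_or_lt with rfl | h'
    · simp [eq_comm]
    · have : i - u.length ≠ 0 := by omega
      simp [this, h'.ne', List.getElem?_eq_none h'.le]

theorem lt_of_mem_listEvents {u : List (T × P)} {x : ℕ × T × P} (h : x ∈ listEvents u) :
    x.1 < u.length := by
  by_contra h'
  rw [listEvents, Set.mem_ofPred_eq, List.getElem?_eq_none (not_lt.1 h')] at h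
  cases h

theorem eq_of_mem_listEvents {u : List (T × P)} {x y : ℕ × T × P} (h : x ∈ listEvents u)
    (h' : y ∈ listEvents u) (hxy : x.1 = y.1) : x = y := by
  refine Prod.ext hxy ?_
  have h1 : u[x.1]? = some x.2 := h
  have h2 : u[y.1]? = some y.2 := h'
  rw [hxy, h2] at h1
  exact (Option.some.inj h1).symm

theorem listEvents_nil : listEvents ([] : List (T × P)) = ∅ := by
  ext x
  simp [listEvents]

theorem correct_empty : M.Correct (∅ : Set (ℕ × T × P)) := by
  constructor <;> simp

/-- The live pushes on stack `k`. -/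
def livePush (E : Set (ℕ × T × P)) (k : K) : Set (ℕ × Γ) :=
  {x | ∃ t p, (x.1, t, p) ∈ E ∧ M.op t = .push k x.2 ∧ ¬ M.Dead E p}

/-- The trace `u` represents the configuration with state `q` and stacks `S`. -/
structure Represents (u : List (T × P)) (q : Q) (S : K → List Γ) : Prop where
  start : u = [] → q = M.start
  state : ∀ v a, u = v ++ [a] → q = M.dst a.1
  stack : ∀ k, ∃ L : List (ℕ × Γ), S k = L.map Prod.snd ∧ L.Pairwise (fun x y => y.1 < x.1) ∧
    ∀ x, x ∈ L ↔ x ∈ M.livePush (listEvents u) k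

theorem represents_nil : M.Represents ([] : List (T × P)) M.start (fun _ => []) :=
  ⟨fun _ => rfl, fun v a h => by simp at h, fun k => ⟨[], rfl, .nil, fun x => by
    simp [livePush, listEvents_nil]⟩⟩

variable {M}

/-! ### Traces extended by one move -/

theorem last_concat (u : List (T × P)) (a : T × P) :
    Last (listEvents (u ++ [a])) (u.length, a) := by
  intro y hy h
  have := lt_of_mem_listEvents hy
  simp at this h
  omega

theorem mem_concat (u : List (T × P)) (a : T × P) :
    (u.length, a) ∈ listEvents (u ++ [a]) := by
  rw [listEvents_concat]
  exact Set.mem_insert _ _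

theorem last_concat_iff {u : List (T × P)} {a : T × P} {x : ℕ × T × P}
    (hx : x ∈ listEvents (u ++ [a])) : Last (listEvents (u ++ [a])) x ↔ x = (u.length, a) := by
  constructor
  · intro h
    have h1 := h _ (mem_concat u a)
    have h2 := lt_of_mem_listEvents hx
    simp at h1 h2
    exact eq_of_mem_listEvents hx (mem_concat u a) (by simp; omega)
  · rintro rfl
    exact last_concat u a

theorem mem_listEvents_concat {u : List (T × P)} {a : T × P} {x : ℕ × T × P}
    (hx : x ∈ listEvents (u ++ [a])) : x = (u.length, a) ∨ x ∈ listEvents u := by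
  rwa [listEvents_concat] at hx

theorem subset_listEvents_concat {u : List (T × P)} {a : T × P} {x : ℕ × T × P}
    (hx : x ∈ listEvents u) : x ∈ listEvents (u ++ [a]) := by
  rw [listEvents_concat]
  exact Set.mem_insert_of_mem _ hx

theorem dead_concat {u : List (T × P)} {a : T × P} {p : P} :
    M.Dead (listEvents (u ++ [a])) p ↔ (a.2 = p ∧ M.IsPop a.1) ∨ M.Dead (listEvents u) p := by
  simp [Dead, listEvents_concat]

theorem beforeLast_concat {u : List (T × P)} {a b : T × P} {y : ℕ × T × P}
    (hy : y ∈ listEvents ((u ++ [b]) ++ [a])) :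
    BeforeLast (listEvents ((u ++ [b]) ++ [a])) y ↔ y = (u.length, b) := by
  have hb : (u.length, b) ∈ listEvents ((u ++ [b]) ++ [a]) :=
    subset_listEvents_concat (mem_concat u b)
  have hlt := lt_of_mem_listEvents hy
  simp at hlt
  constructor
  · rintro ⟨h1, h2⟩
    rw [last_concat_iff hy] at h1
    have h3 := h2 _ hb
    rw [last_concat_iff hb] at h3
    have h4 : ¬ y.1 < u.length := fun h => by simpa using congrArg Prod.fst (h3 h)
    have h5 : y.1 ≠ u.length + 1 := fun h =>
      h1 (eq_of_mem_listEvents hy (mem_concat _ a) (by simpa using h))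
    exact eq_of_mem_listEvents hy hb (by simp; omega)
  · rintro rfl
    refine ⟨fun h => by simpa using congrArg Prod.fst ((last_concat_iff hy).1 h), ?_⟩
    intro x hx hlt'
    have := lt_of_mem_listEvents hx
    simp at this hlt'
    rw [last_concat_iff hx]
    exact eq_of_mem_listEvents hx (mem_concat _ a) (by simp; omega)

theorem not_isLook_of_push {t : T} {k : K} {c : Γ} (h : M.op t = .push k c) : ¬ M.IsLook t := by
  rintro ⟨k', c', b, h'⟩
  rw [h] at h'
  cases h'

theorem IsPop.isLook {t : T} (h : M.IsPop t) : M.IsLook t := by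
  obtain ⟨k, a, h⟩ := h
  exact ⟨k, a, true, h⟩

/-- By `fresh`, the later of two events on one process must be a look. A process therefore
determines the symbol pushed on it. -/
theorem Correct.unique {E : Set (ℕ × T × P)} (hE : M.Correct E) {x y : ℕ × T × P} (hx : x ∈ E)
    (hy : y ∈ E) (hp : x.2.2 = y.2.2) (hx' : ¬ M.IsLook x.2.1) (hy' : ¬ M.IsLook y.2.1) :
    x.1 = y.1 := by
  rcases lt_trichotomy x.1 y.1 with h | h | h
  · exact (hy' (hE.fresh y hy x hx h hp)).elim
  · exact h
  · exact (hx' (hE.fresh x hx y hy h hp.symm)).elim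

theorem mem_livePush_concat {u : List (T × P)} {a : T × P} {k : K} {x : ℕ × Γ} :
    x ∈ M.livePush (listEvents (u ++ [a])) k ↔
      (x.1 = u.length ∧ M.op a.1 = .push k x.2 ∧ ¬ M.Dead (listEvents (u ++ [a])) a.2) ∨
      ∃ t p, (x.1, t, p) ∈ listEvents u ∧ M.op t = .push k x.2 ∧
        ¬ M.Dead (listEvents (u ++ [a])) p := by
  simp only [livePush, Set.mem_ofPred_eq]
  constructor
  · rintro ⟨t, p, h, h1, h2⟩
    rcases mem_listEvents_concat h with h | h
    · obtain rfl : (t, p) = a := congrArg Prod.snd h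
      exact .inl ⟨congrArg Prod.fst h, h1, h2⟩
    · exact .inr ⟨t, p, h, h1, h2⟩
  · rintro (⟨h, h1, h2⟩ | ⟨t, p, h, h1, h2⟩)
    · exact ⟨a.1, a.2, by rw [h]; exact mem_concat u a, h1, h2⟩
    · exact ⟨t, p, subset_listEvents_concat h, h1, h2⟩

theorem dead_concat_of_not_isPop {u : List (T × P)} {a : T × P} (ha : ¬ M.IsPop a.1) {p : P} :
    M.Dead (listEvents (u ++ [a])) p ↔ M.Dead (listEvents u) p := by
  simp [dead_concat, ha]

theorem livePush_concat {u : List (T × P)} {a : T × P} {k : K} (ha : ¬ M.IsPop a.1)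
    (hk : ∀ c, M.op a.1 ≠ .push k c) :
    M.livePush (listEvents (u ++ [a])) k = M.livePush (listEvents u) k := by
  ext x
  rw [mem_livePush_concat]
  simp [hk, dead_concat_of_not_isPop ha, livePush]

/-! ### Correct traces and runs -/

/-- A trace is correct if all its prefixes are. -/
def CorrectTrace (M : StackMachine T K Γ Q) (u : List (T × P)) : Prop :=
  ∀ n, M.Correct (listEvents (u.take n))

theorem CorrectTrace.of_append {u v : List (T × P)} (h : M.CorrectTrace (u ++ v)) :
    M.CorrectTrace u := by
  intro n
  have := h (min n u.length)
  rwa [List.take_append_of_le_length (min_le_right _ _), ← List.take_take, List.take_length] at this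

variable [DecidableEq K]

/-- A correct move is a step of the machine. -/
theorem Represents.rel_of_correct {u : List (T × P)} {a : T × P} {q : Q} {S : K → List Γ}
    (hu : M.Represents u q S) (ha : M.Correct (listEvents (u ++ [a]))) :
    M.src a.1 = q ∧
      ∃ S', (M.op a.1).Rel S S' ∧ M.Represents (u ++ [a]) (M.dst a.1) S' := by
  have hmem := mem_concat u a
  have hlast := last_concat u a
  have hold : ∀ {x}, x ∈ listEvents u → x ∈ listEvents (u ++ [a]) := subset_listEvents_concat
  constructor
  · rcases List.eq_nil_or_concat u with rfl | ⟨v, b, rfl⟩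
    · rw [hu.start rfl]
      exact ha.first _ hmem (by rintro ⟨y, -, hy⟩; simp at hy)
    · rw [List.concat_eq_append] at *
      rw [hu.state v b rfl]
      exact (ha.next _ hmem hlast (v.length, b) (hold (mem_concat v b))
        ((beforeLast_concat (hold (mem_concat v b))).2 rfl)).symm
  have hstart : u ++ [a] = [] → M.dst a.1 = M.start := fun h => by simp at h
  have hstate : ∀ v b, u ++ [a] = v ++ [b] → M.dst a.1 = M.dst b.1 := fun v b h => by
    rw [List.append_inj_right' h rfl |> List.singleton_inj.1]
  rcases hop : M.op a.1 with ⟨k, c⟩ | ⟨k, c, b⟩ | k | _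
  · have hl : ¬ M.IsLook a.1 := not_isLook_of_push hop
    have hpop : ¬ M.IsPop a.1 := fun h => hl h.isLook
    refine ⟨_, rfl, hstart, hstate, fun k' => ?_⟩
    obtain ⟨L, hL, hs, hm⟩ := hu.stack k'
    by_cases hk : k' = k
    · subst hk
      refine ⟨(u.length, c) :: L, by simp [hL], List.pairwise_cons.2 ⟨fun x hx => ?_, hs⟩,
        fun x => ?_⟩
      · obtain ⟨t, p, hx, -⟩ := (hm x).1 hx
        exact lt_of_mem_listEvents hx
      · rw [List.mem_cons, hm, mem_livePush_concat]
        simp only [dead_concat_of_not_isPop hpop, hop]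
        -- The process of a push is fresh, so nothing has been removed from it.
        have hd : ¬ M.Dead (listEvents u) a.2 := by
          rintro ⟨y, hy, hya, -⟩
          exact hl (ha.fresh _ hmem y (hold hy) (lt_of_mem_listEvents hy) hya)
        refine or_congr ⟨?_, ?_⟩ Iff.rfl
        · rintro rfl
          exact ⟨rfl, rfl, hd⟩
        · rintro ⟨h1, h2, -⟩
          exact Prod.ext h1 (by injection h2 with _ h; exact h.symm)
    · refine ⟨L, by rw [update_of_ne hk, hL], hs, fun x => ?_⟩
      rw [livePush_concat hpop, hm]
      intro c' h
      rw [hop] at h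
      injection h with h
      exact hk h.symm
  · have hlook : M.IsLook a.1 := ⟨k, c, b, hop⟩
    obtain ⟨⟨i, t, p⟩, hy, hlt, hp, k', c', b', h1, h2⟩ := ha.reads _ hmem hlook
    simp only [hop, StackOp.look.injEq] at h1 hp hlt h2
    obtain ⟨rfl, rfl, rfl⟩ := h1
    subst hp
    have hyu : (i, t, a.2) ∈ listEvents u := by
      rcases mem_listEvents_concat hy with h | h
      · exact (hlt.ne (congrArg Prod.fst h)).elim
      · exact h
    have hylook := not_isLook_of_push h2
    obtain ⟨L, hL, hs, hm⟩ := hu.stack k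
    -- By `live`, no earlier event has removed the symbol, so its push is still represented in the
    -- stack.
    have hmemL : (i, c) ∈ L := by
      refine (hm _).2 ⟨t, a.2, hyu, h2, ?_⟩
      rintro ⟨z, hz, hza, hpop⟩
      exact ha.live _ hmem z (hold hz) (lt_of_mem_listEvents hz) hza hpop
    cases L with
    | nil => simp at hmemL
    | cons e L =>
    have hsame : ∀ {j t' k'' c''}, (j, t', a.2) ∈ listEvents u → M.op t' = .push k'' c'' →
        j = i := fun hj hpush =>
      ha.unique (hold hj) hy rfl (not_isLook_of_push hpush) hylook
    -- If the top were another push `e`, it would be later than `i`, hence dead by `top`. It was not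
    -- dead before, and the new move can only kill its own process, on which the sole push is the
    -- one at `i`.
    have he : e = (i, c) := by
      by_contra hne
      have hmem' : (i, c) ∈ L := (List.mem_cons.1 hmemL).resolve_left (Ne.symm hne)
      have hei := (List.pairwise_cons.1 hs).1 _ hmem'
      obtain ⟨t', p', he, hpush, hd⟩ := (hm e).1 List.mem_cons_self
      have := ha.top _ hy ⟨_, hmem, rfl, hlast, hlook⟩ _ (hold he) hei ⟨k, c, e.2, h2, hpush⟩
      rw [dead_concat] at this
      rcases this with ⟨rfl, -⟩ | h
      · exact hei.ne' (hsame he hpush)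
      · exact hd h
    subst he
    have hSk : S k = c :: L.map Prod.snd := by simp [hL]
    refine ⟨_, ⟨_, hSk, rfl⟩, hstart, hstate, fun k' => ?_⟩
    have hpush : ∀ k c, M.op a.1 ≠ .push k c := fun k c h => by rw [hop] at h; cases h
    cases b with
    | false =>
      have hpop : ¬ M.IsPop a.1 := by
        rintro ⟨k', c', h⟩
        rw [hop] at h
        cases h
      rw [livePush_concat hpop (hpush k')]
      exact hu.stack k'
    | true =>
      simp only [if_true]
      have hpop : M.IsPop a.1 := ⟨k, c, hop⟩
      by_cases hk : k' = k
      · subst hk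
        refine ⟨L, by simp, (List.pairwise_cons.1 hs).2, fun x => ?_⟩
        rw [mem_livePush_concat]
        simp only [hpush, false_and, and_false, false_or, dead_concat, hpop, and_true, not_or]
        constructor
        · intro hx
          obtain ⟨t', p', hx1, hx2, hx3⟩ := (hm x).1 (List.mem_cons_of_mem _ hx)
          refine ⟨t', p', hx1, hx2, ?_, hx3⟩
          rintro rfl
          exact ((List.pairwise_cons.1 hs).1 x hx).ne (hsame hx1 hx2)
        · rintro ⟨t', p', hx1, hx2, hx3, hx4⟩
          refine (List.mem_cons.1 ((hm x).2 ⟨t', p', hx1, hx2, hx4⟩)).resolve_left ?_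
          rintro rfl
          exact hx3 (congrArg (fun z => z.2.2) (eq_of_mem_listEvents hyu hx1 rfl))
      · obtain ⟨L', hL', hs', hm'⟩ := hu.stack k'
        refine ⟨L', by rw [update_of_ne hk, hL'], hs', fun x => ?_⟩
        rw [hm', mem_livePush_concat]
        simp only [hpush, false_and, and_false, false_or, dead_concat, hpop, and_true, not_or]
        refine exists_congr fun t' => exists_congr fun p' => and_congr_right fun hx1 =>
          and_congr_right fun hx2 => ⟨fun h => ⟨?_, h⟩, And.right⟩
        rintro rfl
        have h3 := eq_of_mem_listEvents hyu hx1 (hsame hx1 hx2).symm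
        simp only [Prod.mk.injEq, and_true] at h3
        rw [← h3.2, h2] at hx2
        injection hx2 with h4
        exact hk h4.symm
  · have hl : ¬ M.IsLook a.1 := by
      rintro ⟨k', c', b, h⟩
      rw [hop] at h
      cases h
    have hpop : ¬ M.IsPop a.1 := fun h => hl h.isLook
    refine ⟨S, ⟨?_, rfl⟩, hstart, hstate, fun k' => ?_⟩
    · obtain ⟨L, hL, -, hm⟩ := hu.stack k
      cases L with
      | nil => exact hL
      | cons e L =>
        obtain ⟨t', p', he, hpush, hd⟩ := (hm e).1 List.mem_cons_self
        refine (hd ?_).elim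
        rw [← dead_concat_of_not_isPop hpop]
        exact ha.empty _ hmem hlast _ (hold he) ⟨k, _, hop, hpush⟩
    · rw [livePush_concat hpop fun c h => by rw [hop] at h; cases h]
      exact hu.stack k'
  · have hpop : ¬ M.IsPop a.1 := by
      rintro ⟨k', c', h⟩
      rw [hop] at h
      cases h
    refine ⟨S, rfl, hstart, hstate, fun k' => ?_⟩
    rw [livePush_concat hpop fun c h => by rw [hop] at h; cases h]
    exact hu.stack k'

/-- Every step of the machine is a correct move, provided that a fresh process is available. -/
theorem Represents.correct_of_rel {u : List (T × P)} {q : Q} {S S' : K → List Γ}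
    (hu : M.Represents u q S) (hc : M.Correct (listEvents u)) {t : T} (hq : M.src t = q)
    (hS : (M.op t).Rel S S') (hp : ∃ p : P, ∀ x ∈ listEvents u, x.2.2 ≠ p) :
    ∃ p, M.Correct (listEvents (u ++ [(t, p)])) := by
  -- A look is played on the process of the symbol on top of its stack, any other transition on a
  -- fresh process. The final conjunct says that no live push on that stack is later, as the clause
  -- `top` demands.
  have key : ∃ p : P, (¬ M.IsLook t → ∀ x ∈ listEvents u, x.2.2 ≠ p) ∧
      (M.IsLook t → ¬ M.Dead (listEvents u) p ∧ ∃ y ∈ listEvents u, y.2.2 = p ∧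
        M.Reads t y.2.1 ∧ ∀ k c, M.op y.2.1 = .push k c →
          ∀ z ∈ M.livePush (listEvents u) k, z.1 ≤ y.1) := by
    by_cases hl : M.IsLook t
    · obtain ⟨k, c, b, hop⟩ := hl
      rw [hop] at hS
      obtain ⟨l, hl, -⟩ := hS
      obtain ⟨L, hL, hs, hm⟩ := hu.stack k
      rw [hl] at hL
      cases L with
      | nil => cases hL
      | cons e L =>
        simp only [List.map_cons, List.cons.injEq] at hL
        obtain ⟨t', p', he, hpush, hd⟩ := (hm e).1 List.mem_cons_self
        refine ⟨p', fun h => (h ⟨k, c, b, hop⟩).elim, fun _ => ⟨hd, _, he, rfl,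
          ⟨k, c, b, hop, by rw [hpush, hL.1]⟩, fun k' c' hk z hz => ?_⟩⟩
        rw [hpush] at hk
        injection hk with hk _
        subst hk
        rcases List.mem_cons.1 ((hm z).2 hz) with rfl | hz
        · exact le_rfl
        · exact ((List.pairwise_cons.1 hs).1 z hz).le
    · obtain ⟨p, hp⟩ := hp
      exact ⟨p, fun _ => hp, fun h => (hl h).elim⟩
  obtain ⟨p, hfresh, hlook⟩ := key
  have hold : ∀ {x}, x ∈ listEvents u → x ∈ listEvents (u ++ [(t, p)]) := subset_listEvents_concat
  have hearlier : ∀ {x y}, x ∈ listEvents (u ++ [(t, p)]) → y ∈ listEvents (u ++ [(t, p)]) →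
      y.1 < x.1 → y ∈ listEvents u := by
    intro x y hx hy hlt
    rcases mem_listEvents_concat hy with rfl | h
    · exact (last_concat u (t, p) x hx hlt).elim
    · exact h
  have hdead : ∀ {p'}, M.Dead (listEvents u) p' → M.Dead (listEvents (u ++ [(t, p)])) p' :=
    fun h => dead_concat.2 (.inr h)
  refine ⟨p, ?_, ?_, ?_, ?_, ?_, ?_, ?_⟩
  · intro x hx hno
    rcases mem_listEvents_concat hx with rfl | h
    · rw [hq]
      refine hu.start ?_
      rcases List.eq_nil_or_concat u with rfl | ⟨v, b, rfl⟩
      · rfl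
      · rw [List.concat_eq_append] at *
        exact (hno ⟨_, hold (mem_concat v b), by simp⟩).elim
    · exact hc.first x h fun ⟨y, hy, hlt⟩ => hno ⟨y, hold hy, hlt⟩
  · intro x hx y hy hlt hxy
    have hy' := hearlier hx hy hlt
    rcases mem_listEvents_concat hx with rfl | h
    · by_contra hl
      exact hfresh hl y hy' hxy
    · exact hc.fresh x h y hy' hlt hxy
  · intro x hx hl
    rcases mem_listEvents_concat hx with rfl | h
    · obtain ⟨-, y, hy, hyp, hr, -⟩ := hlook hl
      exact ⟨y, hold hy, lt_of_mem_listEvents hy, hyp, hr⟩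
    · obtain ⟨y, hy, h'⟩ := hc.reads x h hl
      exact ⟨y, hold hy, h'⟩
  · intro x hx y hy hlt hxy
    have hy' := hearlier hx hy hlt
    rcases mem_listEvents_concat hx with rfl | h
    · by_cases hl : M.IsLook t
      · exact fun hpop => (hlook hl).1 ⟨y, hy', hxy, hpop⟩
      · exact (hfresh hl y hy' hxy).elim
    · exact hc.live x h y hy' hlt hxy
  · intro x hx hlast y hy hb
    rw [last_concat_iff hx] at hlast
    subst hlast
    rcases List.eq_nil_or_concat u with rfl | ⟨v, b, rfl⟩
    · rcases mem_listEvents_concat hy with rfl | h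
      · exact (hb.1 (last_concat [] _)).elim
      · simp [listEvents_nil] at h
    · rw [List.concat_eq_append] at *
      rw [beforeLast_concat hy] at hb
      subst hb
      exact ((hu.state v b rfl).symm.trans hq.symm)
  · rintro z hz ⟨x, hx, hxz, hlast, hl⟩ y hy hlt ⟨k, c, c', hzpush, hypush⟩
    rw [last_concat_iff hx] at hlast
    subst hlast
    have hz' : z ∈ listEvents u := by
      rcases mem_listEvents_concat hz with rfl | h
      · exact (not_isLook_of_push hzpush hl).elim
      · exact h
    have hy' : y ∈ listEvents u := by
      rcases mem_listEvents_concat hy with rfl | h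
      · exact (not_isLook_of_push hypush hl).elim
      · exact h
    obtain ⟨-, e, he, hep, ⟨k', c'', b, -, hepush⟩, htop⟩ := hlook hl
    have hez : e = z := eq_of_mem_listEvents he hz' (hc.unique he hz' (hep.trans hxz)
      (not_isLook_of_push hepush) (not_isLook_of_push hzpush))
    subst hez
    by_contra hd
    exact hlt.not_ge (htop k c hzpush (y.1, c') ⟨_, _, hy', hypush, fun h => hd (hdead h)⟩)
  · rintro x hx hlast y hy ⟨k, c, hempty, hpush⟩
    rw [last_concat_iff hx] at hlast
    subst hlast
    have hy' : y ∈ listEvents u := by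
      rcases mem_listEvents_concat hy with rfl | h
      · rw [hempty] at hpush
        cases hpush
      · exact h
    by_contra hd
    obtain ⟨L, hL, -, hm⟩ := hu.stack k
    rw [hempty] at hS
    rw [hS.1, eq_comm, List.map_eq_nil_iff] at hL
    subst hL
    simpa using (hm (y.1, c)).2 ⟨_, _, hy', hpush, fun h => hd (hdead h)⟩

/-- Runs of the machine from the start state and empty stacks. -/
inductive Run (M : StackMachine T K Γ Q) : List T → Q → (K → List Γ) → Prop
  | nil : Run M [] M.start fun _ => []
  | snoc {l q S t S'} (h : Run M l q S) (hq : M.src t = q) (hS : (M.op t).Rel S S') :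
      Run M (l ++ [t]) (M.dst t) S'

theorem CorrectTrace.run {u : List (T × P)} (h : M.CorrectTrace u) :
    ∃ q S, M.Run (u.map Prod.fst) q S ∧ M.Represents u q S := by
  induction u using List.reverseRecOn with
  | nil => exact ⟨_, _, .nil, M.represents_nil⟩
  | append_singleton u a ih =>
    obtain ⟨q, S, hr, hu⟩ := ih h.of_append
    have ha := h (u.length + 1)
    rw [List.take_of_length_le (by simp)] at ha
    obtain ⟨hq, S', hS, hu'⟩ := hu.rel_of_correct ha
    refine ⟨_, S', ?_, hu'⟩
    rw [List.map_append]
    exact hr.snoc hq hS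

theorem Run.correctTrace {l : List T} {q : Q} {S : K → List Γ} (h : M.Run l q S) [Fintype P]
    (hP : l.length ≤ Fintype.card P) :
    ∃ u : List (T × P), u.map Prod.fst = l ∧ M.CorrectTrace u ∧ M.Represents u q S := by
  classical
  induction h with
  | nil => exact ⟨[], rfl, fun n => by simpa [listEvents_nil] using M.correct_empty,
      M.represents_nil⟩
  | @snoc l q S t S' h hq hS ih =>
    simp only [List.length_append, List.length_singleton] at hP
    obtain ⟨u, rfl, hc, hu⟩ := ih (by omega)
    have hcu := hc u.length
    rw [List.take_length] at hcu
    have hp : ∃ p : P, ∀ x ∈ listEvents u, x.2.2 ≠ p := by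
      -- Each earlier move uses at most one process, so the bound on the length of the run leaves
      -- one unused.
      have hlt : (u.map Prod.snd).toFinset.card < (Finset.univ : Finset P).card := by
        refine (List.toFinset_card_le _).trans_lt ?_
        simpa using hP
      obtain ⟨p, -, hp⟩ := Finset.exists_mem_notMem_of_card_lt_card hlt
      refine ⟨p, fun x hx hxp => hp ?_⟩
      rw [List.mem_toFinset, List.mem_map]
      exact ⟨x.2, List.mem_of_getElem? hx, hxp⟩
    obtain ⟨p, ha⟩ := hu.correct_of_rel hcu hq hS hp
    obtain ⟨-, S'', hS'', hu'⟩ := hu.rel_of_correct ha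
    refine ⟨u ++ [(t, p)], by simp, fun n => ?_, ?_⟩
    · rcases le_or_gt n u.length with hn | hn
      · rw [List.take_append_of_le_length hn]
        exact hc n
      · rwa [List.take_of_length_le (by simp; omega)]
    · rwa [hS.unique hS'']

end StackMachine

/-! ### Plays in which Environment falls silent -/

namespace Strategy

variable {AS AE PS PE PM : Type}

/-- The history after `k` rounds in which Environment does not move, starting from `h`. -/
def hist (σ : Strategy AS AE PS PE PM) (h : List (Move AS AE PS PE PM)) :
    ℕ → List (Move AS AE PS PE PM)
  | 0 => h
  | k + 1 => hist σ h k ++ ((σ (hist σ h k)).map Sum.inl).toList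

variable {σ : Strategy AS AE PS PE PM} {h : List (Move AS AE PS PE PM)}

theorem hist_succ_of_none {k : ℕ} (hk : σ (σ.hist h k) = none) :
    σ.hist h (k + 1) = σ.hist h k := by
  simp [hist, hk]

theorem hist_eq_of_none {k j : ℕ} (hk : σ (σ.hist h k) = none) (hj : k ≤ j) :
    σ.hist h j = σ.hist h k := by
  induction hj with
  | refl => rfl
  | step _ ih => rw [Nat.succ_eq_add_one, hist_succ_of_none (by rwa [ih]), ih]

theorem hist_prefix {k j : ℕ} (hj : k ≤ j) : σ.hist h k <+: σ.hist h j := by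
  induction hj with
  | refl => exact List.prefix_refl _
  | step _ ih => exact ih.trans (List.prefix_append _ _)

theorem length_hist_le (k : ℕ) : (σ.hist h k).length ≤ h.length + k := by
  induction k with
  | zero => exact le_rfl
  | succ k ih =>
    cases hk : σ (σ.hist h k) <;> simp [hist, hk] <;> omega

/-- Each round adds at most one move, so a history that is too short has been stalled by a pass; the
strategy then faces the same history again and passes again. -/
theorem eq_none_of_length_hist_lt {k : ℕ} (hk : (σ.hist h k).length < h.length + k) :
    σ (σ.hist h k) = none := by
  induction k with
  | zero => exact (lt_irrefl _ hk).elim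
  | succ k ih =>
    cases hs : σ (σ.hist h k) with
    | none => rwa [hist_succ_of_none hs]
    | some m =>
      rw [ih (by simp [hist, hs] at hk; omega)] at hs
      cases hs

/-- After `i + 1` rounds index `i` is final: either it is filled, or a pass has stalled the history
before it. -/
theorem getElem?_hist {k i : ℕ} (hi : i < (σ.hist h k).length) :
    (σ.hist h (i + 1))[i]? = (σ.hist h k)[i]? := by
  rcases le_total k (i + 1) with hk | hk
  · exact List.prefix_iff_getElem?.1 (hist_prefix hk) i hi |>.trans
      (List.getElem?_eq_getElem hi).symm
  · by_cases hi' : i < (σ.hist h (i + 1)).length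
    · exact (List.getElem?_eq_getElem hi').trans
        (List.prefix_iff_getElem?.1 (hist_prefix hk) i hi').symm
    · rw [hist_eq_of_none (eq_none_of_length_hist_lt (by omega)) hk]

/-- The word obtained from the history `h` when Environment does not move any more. -/
def play (σ : Strategy AS AE PS PE PM) (h : List (Move AS AE PS PE PM)) :
    DataWord AS AE PS PE PM :=
  ⟨fun i => (σ.hist h (i + 1))[i]?, fun {n} hn => by
    rw [List.getElem?_eq_none_iff] at hn ⊢
    rw [hist_eq_of_none (eq_none_of_length_hist_lt (by omega)) (Nat.le_succ _)]
    exact hn.trans (Nat.le_succ _)⟩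

theorem get?_play {k i : ℕ} (hi : i < (σ.hist h k).length) :
    (σ.play h).get? i = (σ.hist h k)[i]? := getElem?_hist hi

theorem take_play {k i : ℕ} (hi : i ≤ (σ.hist h k).length) :
    (σ.play h).take i = (σ.hist h k).take i := by
  ext1 j
  rw [Stream'.Seq.getElem?_take, List.getElem?_take]
  split_ifs with hj
  · exact get?_play (by omega)
  · rfl

theorem get?_play_of_lt {i : ℕ} (hi : i < h.length) : (σ.play h).get? i = h[i]? :=
  get?_play (k := 0) hi

/-- Index `h.length + k` is filled when the strategy answers `hist h k`, provided that no earlier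
round was a pass; that history is then exactly the prefix of the play before this index. -/
theorem strategy_take_play {i : ℕ} {m : Move AS AE PS PE PM} (hi : h.length ≤ i)
    (hm : (σ.play h).get? i = some m) : ∃ m', m = .inl m' ∧ σ ((σ.play h).take i) = some m' := by
  obtain ⟨k, rfl⟩ := Nat.exists_eq_add_of_le hi
  have hlt : h.length + k < (σ.hist h (h.length + k + 1)).length := by
    by_contra hlt
    have : (σ.play h).get? (h.length + k) = none :=
      List.getElem?_eq_none (not_lt.1 hlt)
    rw [this] at hm
    cases hm
  have hsome : σ (σ.hist h k) ≠ none := by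
    intro hn
    rw [hist_eq_of_none hn (by omega)] at hlt
    have := length_hist_le (σ := σ) (h := h) k
    omega
  have hlen : (σ.hist h k).length = h.length + k :=
    le_antisymm (length_hist_le k) (not_lt.1 fun hl => hsome (eq_none_of_length_hist_lt hl))
  obtain ⟨m', hm'⟩ := Option.ne_none_iff_exists'.1 hsome
  refine ⟨m', ?_, ?_⟩
  · rw [get?_play (k := k + 1) (by simp [hist, hm', hlen])] at hm
    simp only [hist, hm', Option.map_some, Option.toList_some, ← hlen,
      List.getElem?_concat_length, Option.some.injEq] at hm
    exact hm.symm
  · rw [take_play hlen.ge, ← hlen, List.take_length, hm']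

theorem compatible_play
    (hh : ∀ (i : ℕ) (m : SysMove AS PS PM), h[i]? = some (.inl m) → σ (h.take i) = some m) :
    σ.Compatible (σ.play h) := by
  refine ⟨fun i m hm => ?_, fun i hi => ?_⟩
  · by_cases hi : i < h.length
    · rw [get?_play_of_lt hi] at hm
      rw [take_play (k := 0) hi.le]
      exact hh i m hm
    · obtain ⟨m', h1, h2⟩ := strategy_take_play (not_lt.1 hi) hm
      cases h1
      exact h2
  · have hlen : (σ.hist h (i + 1)).length ≤ i := List.getElem?_eq_none_iff.1 hi
    have : (σ.play h).take i = σ.hist h (i + 1) := by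
      ext1 j
      rw [Stream'.Seq.getElem?_take]
      split_ifs with hj
      · by_cases hj' : j < (σ.hist h (i + 1)).length
        · exact get?_play hj'
        · rw [List.getElem?_eq_none (not_lt.1 hj')]
          have hj'' : (σ.hist h (j + 1)).length ≤ j :=
            (hist_prefix (by omega)).length_le.trans (not_lt.1 hj')
          exact List.getElem?_eq_none hj''
      · exact (List.getElem?_eq_none (by omega)).symm
    rw [this]
    exact eq_none_of_length_hist_lt (by omega)

/-- A finite word has finitely many positions at which System could want to play; in an infinite one
every position beyond `h` is a move of System. -/
theorem fair_play : σ.Fair (σ.play h) := by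
  intro hinf
  by_cases ht : ∃ n, (σ.play h).TerminatedAt n
  · obtain ⟨n, hn⟩ := ht
    refine (hinf ((Set.finite_lt_nat n).subset fun i hi => ?_)).elim
    by_contra hlt
    exact hi.1 (Stream'.Seq.le_stable _ (not_lt.1 hlt) hn)
  · refine (Set.Ici_infinite h.length).mono fun i hi => ?_
    obtain ⟨m, hm⟩ := Option.ne_none_iff_exists'.1 (fun hn => ht ⟨i, hn⟩)
    obtain ⟨m', rfl, -⟩ := strategy_take_play hi hm
    exact ⟨m', hm⟩

end Strategy

/-! ### The game associated with a machine -/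

section Game

open StackMachine

variable {T K Γ Q PS PE : Type} [DecidableEq K]

/-- The condition that System has to ensure: as soon as Environment moves, System stops and its moves
so far form a correct trace; if Environment never moves then System plays an action in `H` at some
time, and the action `g` at time `N`. -/
def Goal (M : StackMachine T K Γ Q) (H : T → Prop) (g : T) (N : ℕ)
    (w : DataWord T (Fin 1) PS PE Empty) : Prop :=
  (Nonempty PE ∧ (w.HasEnv → w.SysFirst ∧ M.Correct w.events)) ∧
    (w.HasEnv ∨ ((∃ x ∈ w.events, H x.2.1) ∧ ∃ x ∈ w.events, x.1 = N ∧ x.2.1 = g))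

/-- The list of moves of System corresponding to a trace. -/
def sysMoves (u : List (T × PS)) : List (Move T (Fin 1) PS PE Empty) :=
  u.map fun a => .inl (a.1, .inl a.2)

theorem getElem?_sysMoves {u : List (T × PS)} {i : ℕ} {a : T × PS} :
    (sysMoves u : List (Move T (Fin 1) PS PE Empty))[i]? = some (.inl (a.1, .inl a.2)) ↔
      u[i]? = some a := by
  simp [sysMoves, List.getElem?_map, Option.map_eq_some_iff, Prod.ext_iff]

theorem sysMove_eq (m : SysMove T PS Empty) : ∃ a : T × PS, m = (a.1, .inl a.2) := by
  obtain ⟨t, p | p⟩ := m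
  · exact ⟨(t, p), rfl⟩
  · exact p.elim

theorem events_eq_listEvents {w : DataWord T (Fin 1) PS PE Empty} {u : List (T × PS)}
    (hu : ∀ i < u.length, w.get? i = (sysMoves u)[i]?)
    (hw : ∀ i m, w.get? i = some (.inl m) → i < u.length) : w.events = listEvents u := by
  ext x
  rw [DataWord.mem_events]
  constructor
  · intro h
    rw [hu _ (hw _ _ h)] at h
    exact getElem?_sysMoves.1 h
  · intro h
    rw [hu _ (lt_of_mem_listEvents h)]
    exact getElem?_sysMoves.2 h

/-- The play without Environment provides the two required actions; comparing it with the plays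
interrupted after each prefix shows that it is a correct trace. -/
theorem exists_run_of_goal {M : StackMachine T K Γ Q} {H : T → Prop} {g : T} {N : ℕ}
    {σ : Strategy T (Fin 1) PS PE Empty}
    (hσ : ∀ w, σ.Compatible w → σ.Fair w → Goal M H g N w) :
    ∃ l q S, M.Run l q S ∧ (∃ t ∈ l, H t) ∧ l[N]? = some g := by
  have hgoal : ∀ h : List (Move T (Fin 1) PS PE Empty), (∀ (i : ℕ) (m : SysMove T PS Empty),
      h[i]? = some (.inl m) → σ (h.take i) = some m) → Goal M H g N (σ.play h) := fun h hh =>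
    hσ _ (σ.compatible_play hh) σ.fair_play
  obtain ⟨W, hWdef⟩ : ∃ W, W = σ.play [] := ⟨_, rfl⟩
  have hinl : ∀ i m, W.get? i = some m → ∃ a : T × PS, m = .inl (a.1, .inl a.2) ∧
      σ (W.take i) = some (a.1, .inl a.2) := by
    subst hWdef
    intro i m hm
    obtain ⟨m', rfl, h⟩ := σ.strategy_take_play (Nat.zero_le _) hm
    obtain ⟨a, rfl⟩ := sysMove_eq m'
    exact ⟨a, rfl, h⟩
  obtain ⟨⟨⟨e⟩, -⟩, hW⟩ := hgoal [] (by simp)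
  rw [← hWdef] at hW
  obtain ⟨⟨x, hx, hxH⟩, y, hy, hyN, hyg⟩ := hW.resolve_left (by
    rintro ⟨i, m, hm⟩
    obtain ⟨a, h, -⟩ := hinl i _ hm
    cases h)
  -- The play may be infinite; it is cut just after the later of the two witnesses.
  obtain ⟨z, hz, hxz, hyz⟩ : ∃ z ∈ W.events, x.1 ≤ z.1 ∧ y.1 ≤ z.1 := by
    rcases le_total x.1 y.1 with h | h
    · exact ⟨y, hy, h, le_rfl⟩
    · exact ⟨x, hx, le_rfl, h⟩
  obtain ⟨n, hn⟩ : ∃ n, n = z.1 + 1 := ⟨_, rfl⟩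
  have hex : ∀ i : Fin n, ∃ a : T × PS, W.get? i = some (.inl (a.1, .inl a.2)) := by
    intro i
    obtain ⟨m, hm⟩ := Option.ne_none_iff_exists'.1 fun hi : W.get? i = none => by
      rw [DataWord.mem_events, W.le_stable (by omega) hi] at hz
      cases hz
    obtain ⟨a, rfl, -⟩ := hinl i m hm
    exact ⟨a, hm⟩
  choose a ha using hex
  obtain ⟨u, hu⟩ : ∃ u, u = List.ofFn a := ⟨_, rfl⟩
  have hlen : u.length = n := by simp [hu]
  have hget : ∀ i < n, W.get? i = (sysMoves u)[i]? := by
    intro i hi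
    rw [ha ⟨i, hi⟩, eq_comm, getElem?_sysMoves, hu]
    simp [hi]
  have hevent : ∀ v ∈ W.events, v.1 < n → u[v.1]? = some v.2 := by
    intro v hv hvn
    rw [DataWord.mem_events, hget _ hvn] at hv
    exact getElem?_sysMoves.1 hv
  have htrace : M.CorrectTrace u := by
    intro j
    obtain ⟨v, hv⟩ : ∃ v, v = u.take j := ⟨_, rfl⟩
    have hvn : v.length ≤ n := by simp [hv, hlen]
    have hvget : ∀ i < v.length, (sysMoves v : List (Move T (Fin 1) PS PE Empty))[i]? =
        W.get? i := by
      intro i hi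
      rw [hget i (by omega), sysMoves, sysMoves, hv, List.map_take, List.getElem?_take_of_lt]
      simp [hv] at hi
      exact hi.1
    have hvlen : (sysMoves v : List (Move T (Fin 1) PS PE Empty)).length = v.length := by
      simp [sysMoves]
    rw [← hv]
    -- Environment interrupts right after `v`. In the play continued from there, `SysFirst` forbids
    -- further moves of System, so the events are exactly those of `v`.
    obtain ⟨h, hh⟩ : ∃ h : List (Move T (Fin 1) PS PE Empty),
      h = sysMoves v ++ [.inr (0, .inl e)] := ⟨_, rfl⟩
    have hhlen : h.length = v.length + 1 := by simp [hh, hvlen]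
    have hhget : ∀ i < v.length, h[i]? = W.get? i := by
      intro i hi
      rw [hh, List.getElem?_append_left (by omega), hvget i hi]
    have hhenv : h[v.length]? = some (.inr (0, .inl e)) := by
      rw [hh, ← hvlen, List.getElem?_concat_length]
    have hG := hgoal h (by
      intro i m hm
      rcases lt_trichotomy i v.length with hi | hi | hi
      · rw [hhget i hi] at hm
        obtain ⟨b, hb, hσ⟩ := hinl i _ hm
        cases hb
        rw [← hσ]
        congr 1
        ext1 k
        rw [List.getElem?_take, Stream'.Seq.getElem?_take]
        split_ifs with hk
        · exact hhget k (hk.trans hi)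
        · rfl
      · rw [hi, hhenv] at hm
        cases hm
      · rw [List.getElem?_eq_none (by omega)] at hm
        cases hm)
    have henv : (σ.play h).get? v.length = some (.inr (0, .inl e)) := by
      rw [Strategy.get?_play_of_lt (by omega), hhenv]
    obtain ⟨hfirst, hc⟩ := hG.1.2 ⟨_, _, henv⟩
    rwa [events_eq_listEvents (u := v)] at hc
    · intro i hi
      rw [Strategy.get?_play_of_lt (by omega), hhget i hi, hvget i hi]
    · intro i m hm
      refine lt_of_le_of_ne (hfirst _ _ _ _ henv hm) ?_
      rintro rfl
      rw [henv] at hm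
      cases hm
  obtain ⟨q, S, hr, -⟩ := htrace.run
  refine ⟨_, q, S, hr, ⟨x.2.1, ?_, hxH⟩, ?_⟩
  · exact List.mem_map.2 ⟨x.2, List.mem_of_getElem? (hevent x hx (by omega)), rfl⟩
  · rw [List.getElem?_map, ← hyN, hevent y hy (by omega), Option.map_some, hyg]

theorem exists_goal_of_run {M : StackMachine T K Γ Q} {H : T → Prop} {g : T} {N : ℕ}
    {l : List T} {q : Q} {S : K → List Γ} (hr : M.Run l q S) (hH : ∃ t ∈ l, H t)
    (hg : l[N]? = some g) [Fintype PS] (hPS : l.length ≤ Fintype.card PS) [hPE : Nonempty PE] :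
    ∃ σ : Strategy T (Fin 1) PS PE Empty,
      ∀ w, σ.Compatible w → Goal M H g N w := by
  classical
  obtain ⟨u, rfl, hu, -⟩ := hr.correctTrace hPS
  -- The strategy follows the trace while the history is a prefix of it, and passes otherwise.
  obtain ⟨σ, hσ⟩ : ∃ σ : Strategy T (Fin 1) PS PE Empty, ∀ h, σ h =
      if h = (sysMoves u).take h.length then (u[h.length]?).map fun a => (a.1, .inl a.2)
      else none := ⟨_, fun _ => rfl⟩
  have hsys : ∀ (i : ℕ) (v : EnvMove (Fin 1) PE Empty),
      (sysMoves u : List (Move T (Fin 1) PS PE Empty))[i]? ≠ some (.inr v) := by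
    intro i v h
    simp [sysMoves, List.getElem?_map, Option.map_eq_some_iff] at h
  refine ⟨σ, fun w hw => ?_⟩
  have htake : ∀ k ≤ u.length, (∀ i < k, w.get? i = (sysMoves u)[i]?) →
      σ (w.take k) = (u[k]?).map fun a => (a.1, .inl a.2) := by
    intro k hk hget
    have h1 : w.take k = (sysMoves u).take k := by
      ext1 j
      rw [Stream'.Seq.getElem?_take, List.getElem?_take]
      split_ifs with hj
      · exact hget j hj
      · rfl
    have h2 : (w.take k).length = k := by simp [h1, sysMoves, hk]
    rw [hσ, h2, if_pos h1]
  have hstep : ∀ k, (∀ i < k, ∃ m, w.get? i = some (.inl m)) →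
      k ≤ u.length ∧ ∀ i < k, w.get? i = (sysMoves u)[i]? := by
    intro k
    induction k with
    | zero => simp
    | succ k ih =>
      intro h
      obtain ⟨hk, hget⟩ := ih fun i hi => h i (by omega)
      obtain ⟨m, hm⟩ := h k (by omega)
      have h1 := hw.1 k m hm
      rw [htake k hk hget, Option.map_eq_some_iff] at h1
      obtain ⟨a, ha, rfl⟩ := h1
      refine ⟨(List.getElem?_eq_some_iff.1 ha).1, fun i hi => ?_⟩
      rcases (Nat.lt_succ_iff.1 hi).lt_or_eq with hi | rfl
      · exact hget i hi
      · rw [hm, getElem?_sysMoves.2 ha]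
  -- The trace is finite, so some position is not a move of System. At the first such position
  -- either the word ends, with the whole trace played, or Environment interrupts.
  have hex : ∃ k, ∀ m, w.get? k ≠ some (.inl m) := by
    by_contra! hex
    exact (Nat.lt_irrefl _ (hstep (u.length + 1) fun i _ => hex i).1)
  obtain ⟨k, hk, hlt⟩ : ∃ k, (∀ m, w.get? k ≠ some (.inl m)) ∧
      ∀ i < k, ∃ m, w.get? i = some (.inl m) :=
    ⟨Nat.find hex, Nat.find_spec hex, fun i hi => by simpa using Nat.find_min hex hi⟩
  obtain ⟨hku, hget⟩ := hstep k hlt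
  rcases hwk : w.get? k with _ | m | v
  · have h1 := hw.2 k hwk
    rw [htake k hku hget, Option.map_eq_none_iff, List.getElem?_eq_none_iff] at h1
    obtain rfl := le_antisymm hku h1
    have hev : w.events = listEvents u := events_eq_listEvents hget fun i m hm => by
      by_contra hi
      rw [w.le_stable (not_lt.1 hi) hwk] at hm
      cases hm
    have henv : ¬ w.HasEnv := by
      rintro ⟨i, v, hv⟩
      rcases lt_or_ge i u.length with hi | hi
      · exact hsys i v ((hget i hi).symm.trans hv)
      · rw [w.le_stable hi hwk] at hv
        cases hv
    refine ⟨⟨hPE, fun h => (henv h).elim⟩, .inr ?_⟩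
    rw [hev]
    obtain ⟨t, ht, htH⟩ := hH
    obtain ⟨a, ha, rfl⟩ := List.mem_map.1 ht
    obtain ⟨i, hi⟩ := List.mem_iff_getElem?.1 ha
    rw [List.getElem?_map, Option.map_eq_some_iff] at hg
    obtain ⟨b, hb, rfl⟩ := hg
    exact ⟨⟨(i, a), hi, htH⟩, (N, b), hb, rfl, rfl⟩
  · exact (hk m hwk).elim
  -- Every later history contains the move of Environment at index `k`, so it is no prefix of the
  -- trace and the strategy passes.
  · have hinl : ∀ i m, w.get? i = some (.inl m) → i < k := by
      intro i m hm
      by_contra hi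
      rcases (not_lt.1 hi).eq_or_lt with rfl | hi
      · exact hk m hm
      · have h1 := hw.1 i m hm
        rw [hσ] at h1
        split_ifs at h1 with h2
        have h3 := congrArg (fun l => l[k]?) h2
        simp only [Stream'.Seq.getElem?_take, List.getElem?_take, if_pos hi, hwk] at h3
        split_ifs at h3
        exact hsys k v h3.symm
    have hev : w.events = listEvents (u.take k) := by
      refine events_eq_listEvents (fun i hi => ?_) fun i m hm => by
        simpa [hku] using hinl i m hm
      simp only [List.length_take, lt_min_iff] at hi
      rw [hget i hi.1, sysMoves, sysMoves, List.map_take, List.getElem?_take_of_lt hi.1]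
    refine ⟨⟨hPE, fun _ => ⟨?_, hev ▸ hu k⟩⟩, .inl ⟨k, v, hwk⟩⟩
    intro i v' j m' hi hj
    by_contra hij
    obtain ⟨m, hm⟩ := hlt i ((not_le.1 hij).trans (hinl j m' hj))
    rw [hi] at hm
    cases hm

end Game

/-! ### The sentences and their codes -/

section Sentence

variable {T : Type}

/-- The formula expressing that the position `x` is at least the `n`-th one. -/
def Formula.atLeast {AS AE : Type} : ℕ → Fin 2 → Formula AS AE
  | 0, x => .eq x x
  | n + 1, x => .ex (1 - x) (.conj (.lt (1 - x) x) (atLeast n (1 - x)))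

theorem Formula.sat_atLeast {AS AE PS PE PM : Type} {w : DataWord AS AE PS PE PM} (n : ℕ)
    (x : Fin 2) {v : Fin 2 → Option (Elem w)} {i : ℕ} {m : Move AS AE PS PE PM}
    (hm : w.get? i = some m) (hv : v x = some (.pos i m hm)) : (atLeast n x).Sat w v ↔ n ≤ i := by
  induction n generalizing x v i m with
  | zero => simp [atLeast, Sat, hv]
  | succ n ih =>
    have hx : x ≠ 1 - x := by fin_cases x <;> decide
    simp only [atLeast, Sat, update_self, update_of_ne hx, hv]
    constructor
    · rintro ⟨d, ⟨d', e, hd, he, hlt⟩, h⟩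
      cases hd
      cases he
      cases d with
      | proc => exact hlt.elim
      | pos j m' hm' =>
        have hlt : j < i := hlt
        have := (ih (1 - x) hm' (update_self ..)).1 h
        omega
    · intro h
      obtain ⟨m', hm'⟩ := Stream'.Seq.ge_stable w (show n ≤ i by omega) hm
      refine ⟨.pos n m' hm', ⟨_, _, rfl, rfl, show n < i by omega⟩, ?_⟩
      exact (ih (1 - x) hm' (update_self ..)).2 le_rfl

/-- The formula expressing that System plays the action `g` at time `n`. -/
def Formula.atTime {AS AE : Type} (g : AS) (n : ℕ) : Formula AS AE :=
  .ex 0 (.conj (.act (.inl g) 0) (.conj (atLeast n 0) (.neg (atLeast (n + 1) 0))))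

theorem Formula.sat_atTime {AS AE PS PE : Type} {w : DataWord AS AE PS PE Empty} (g : AS) (n : ℕ)
    (v : Fin 2 → Option (Elem w)) :
    (atTime g n).Sat w v ↔ ∃ x ∈ w.events, x.1 = n ∧ x.2.1 = g := by
  simp only [atTime, Sat, update_self]
  constructor
  · rintro ⟨d, ⟨d', hd', hact⟩, h1, h2⟩
    cases hd'
    obtain ⟨x, rfl, hx⟩ := exists_evElem hact
    replace h1 := (sat_atLeast n 0 x.2 (update_self ..)).1 h1
    replace h2 := mt (sat_atLeast (n + 1) 0 x.2 (update_self ..)).2 h2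
    exact ⟨x, x.2, by omega, hx⟩
  · rintro ⟨x, hx, rfl, rfl⟩
    exact ⟨evElem ⟨x, hx⟩, ⟨_, rfl, (evElem_hasAction _ _).2 rfl⟩,
      (sat_atLeast x.1 0 hx (update_self ..)).2 le_rfl,
      fun h => (Nat.lt_irrefl _ ((sat_atLeast (x.1 + 1) 0 hx (update_self ..)).1 h)).elim⟩

/-- The formulas `φ`, `ψ`, `χ` are chosen before `N`, so their codes are constants of the reduction
and need not be computed. -/
theorem exists_formula_goal {K Γ Q : Type} [Finite T] [DecidableEq K] (M : StackMachine T K Γ Q)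
    (H : T → Prop) (g : T) : ∃ φ ψ χ : Formula T (Fin 1), ∀ {PS PE : Type} (N : ℕ)
      (w : DataWord T (Fin 1) PS PE Empty) (v : Fin 2 → Option (Elem w)),
      (Formula.conj φ (.disj ψ (.conj χ (.atTime g N)))).Sat w v ↔ Goal M H g N w := by
  obtain ⟨φ, hφ⟩ := def0_procE.and (def0_hasEnv.imp (def0_sysFirst.and M.def0_correct))
  obtain ⟨ψ, hψ⟩ := def0_hasEnv (AS := T)
  obtain ⟨χ, hχ⟩ := (def1_action (AE := Fin 1) H).exists
  refine ⟨φ, ψ, χ, fun N w v => ?_⟩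
  simp only [Formula.Sat, Formula.sat_atTime, hφ w v, hψ w v, hχ w v, Goal]

/-- Closure of a formula. -/
def Formula.close {AS AE : Type} (φ : Formula AS AE) : Formula AS AE := .ex 0 (.ex 1 φ)

/-- Definability yields formulas whose truth ignores the assignment but gives no syntactic control
of free variables; two vacuous quantifiers make them sentences. -/
theorem Formula.freeVars_close {AS AE : Type} (φ : Formula AS AE) : φ.close.freeVars = ∅ := by
  ext x
  fin_cases x <;> simp [close, freeVars]

/-- The input whose sentence expresses the condition `Goal`. -/
def goalInput {m : ℕ} (φ ψ χ : Formula (Fin m) (Fin 1)) (g : Fin m) (N : ℕ) : Input where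
  numSys := m
  numEnv := 1
  formula := (Formula.conj φ (.disj ψ (.conj χ (.atTime g N)))).close
  closed := Formula.freeVars_close _

/-- The variable alternates along the recursion, so the codes for both variables are computed
together. -/
theorem Formula.computable_code_atLeast {m n : ℕ} :
    Computable fun k => (atLeast k 0 : Formula (Fin m) (Fin n)).code := by
  have : Primrec fun k => Nat.rec (motive := fun _ => ℕ × ℕ)
      ((atLeast 0 0 : Formula (Fin m) (Fin n)).code, (atLeast 0 1 : Formula (Fin m) (Fin n)).code)
      (fun _ ih => (Nat.pair 10 (Nat.pair 1 (Nat.pair 8 (Nat.pair (Nat.pair 2 (Nat.pair 1 0)) ih.2))),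
        Nat.pair 10 (Nat.pair 0 (Nat.pair 8 (Nat.pair (Nat.pair 2 (Nat.pair 0 1)) ih.1))))) k := by
    refine Primrec.nat_rec₁ _ (Primrec.pair ?_ ?_)
    all_goals
      refine Primrec₂.natPair.comp (.const _) (Primrec₂.natPair.comp (.const _)
        (Primrec₂.natPair.comp (.const _) (Primrec₂.natPair.comp (.const _) ?_)))
    · exact Primrec.snd.comp Primrec.snd
    · exact Primrec.fst.comp Primrec.snd
  refine (Primrec.fst.comp this).to_comp.of_eq fun k => ?_
  suffices h : ∀ k, Nat.rec (motive := fun _ => ℕ × ℕ) _ _ k =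
      ((atLeast k 0 : Formula (Fin m) (Fin n)).code,
        (atLeast k 1 : Formula (Fin m) (Fin n)).code) from congrArg Prod.fst (h k)
  intro k
  induction k with
  | zero => rfl
  | succ k ih => simp only [ih]; rfl

theorem computable_code_goalInput {m : ℕ} (φ ψ χ : Formula (Fin m) (Fin 1)) (g : Fin m) :
    Computable fun N => (goalInput φ ψ χ g N).code := by
  have hpair : ∀ (c : ℕ) {f : ℕ → ℕ}, Computable f → Computable fun N => Nat.pair c (f N) :=
    fun c f hf => Primrec₂.natPair.to_comp.comp (Computable.const c) hf
  have h0 := Formula.computable_code_atLeast (m := m) (n := 1)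
  have h1 := h0.comp Computable.succ
  refine (hpair m (hpair 1 (hpair 10 (hpair 0 (hpair 10 (hpair 1 (hpair 8 (hpair φ.code (hpair 9
    (hpair ψ.code (hpair 8 (hpair χ.code (hpair 10 (hpair 0 (hpair 8
      (hpair (Formula.act (.inl g) 0 : Formula (Fin m) (Fin 1)).code (hpair 8
        (Primrec₂.natPair.to_comp.comp h0 (hpair 7 h1))))))))))))))))))).of_eq fun N => ?_
  simp only [goalInput, Input.code, Formula.close, Formula.atTime, Formula.code, Fin.val_zero,
    Fin.val_one, Nat.succ_eq_add_one]

theorem StackMachine.Run.map {T T' K Γ Q : Type} [DecidableEq K] {M : StackMachine T K Γ Q}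
    {M' : StackMachine T' K Γ Q} (f : T → T') (hsrc : ∀ t, M'.src (f t) = M.src t)
    (hdst : ∀ t, M'.dst (f t) = M.dst t) (hop : ∀ t, M'.op (f t) = M.op t)
    (hstart : M'.start = M.start) {l : List T} {q : Q} {S : K → List Γ} (h : M.Run l q S) :
    M'.Run (l.map f) q S := by
  induction h with
  | nil => exact hstart ▸ .nil
  | snoc h hq hS ih =>
    rw [List.map_append, ← hdst]
    exact ih.snoc ((hsrc _).trans hq) (by rwa [hop])

theorem partSynth_goalInput {m : ℕ} {K Γ Q : Type} [DecidableEq K]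
    {M : StackMachine (Fin m) K Γ Q} {H : Fin m → Prop} {g : Fin m} {N : ℕ}
    {φ ψ χ : Formula (Fin m) (Fin 1)} (h : ∀ {PS PE : Type} (N : ℕ)
      (w : DataWord (Fin m) (Fin 1) PS PE Empty) (v : Fin 2 → Option (Elem w)),
      (Formula.conj φ (.disj ψ (.conj χ (.atTime g N)))).Sat w v ↔ Goal M H g N w) :
    (goalInput φ ψ χ g N).PartSynth ↔
      ∃ l q S, M.Run l q S ∧ (∃ t ∈ l, H t) ∧ l[N]? = some g := by
  have key : ∀ {nS nE : ℕ} (w : DataWord (Fin m) (Fin 1) (Fin nS) (Fin nE) Empty),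
      (goalInput φ ψ χ g N).formula.Holds w ↔ Goal M H g N w := by
    intro nS nE w
    constructor
    · rintro ⟨d, e, h'⟩
      exact (h N w _).1 h'
    · intro h'
      obtain ⟨p⟩ := h'.1.1
      -- The vacuous quantifiers need an element of the structure; the process of Environment
      -- granted by `Goal` is one even when the word is empty.
      exact ⟨.proc (.env p), .proc (.env p), (h N w _).2 h'⟩
  constructor
  · rintro ⟨nS, nE, σ, hσ⟩
    exact exists_run_of_goal fun w hw hw' => (key w).1 (hσ w hw hw')
  · rintro ⟨l, q, S, hr, hH, hg⟩
    obtain ⟨σ, hσ⟩ := exists_goal_of_run (PS := Fin l.length) (PE := Fin 1) hr hH hg (by simp)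
    exact ⟨l.length, 1, σ, fun w hw _ => (key w).2 (hσ w hw)⟩

/-- The instances of the synthesis problem obtained from a machine. -/
theorem exists_input {T K Γ Q : Type} [Finite T] [DecidableEq K] (M : StackMachine T K Γ Q)
    (H : T → Prop) (g : T) : ∃ I : ℕ → Input, (Computable fun N => (I N).code) ∧
      ∀ N, (I N).PartSynth ↔ ∃ l q S, M.Run l q S ∧ (∃ t ∈ l, H t) ∧ l[N]? = some g := by
  obtain ⟨m, ⟨e⟩⟩ := Finite.exists_equiv_fin T
  obtain ⟨M', hM'⟩ : ∃ M' : StackMachine (Fin m) K Γ Q,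
    M' = ⟨M.src ∘ e.symm, M.dst ∘ e.symm, M.op ∘ e.symm, M.start⟩ := ⟨_, rfl⟩
  obtain ⟨φ, ψ, χ, h⟩ := exists_formula_goal M' (H ∘ e.symm) (e g)
  refine ⟨goalInput φ ψ χ (e g), computable_code_goalInput .., fun N =>
    (partSynth_goalInput h).trans ⟨?_, ?_⟩⟩
  · rintro ⟨l, q, S, hr, ⟨t, ht, hH⟩, hg⟩
    refine ⟨_, q, S, hr.map e.symm (by simp [hM']) (by simp [hM']) (by simp [hM']) (by simp [hM']),
      ⟨e.symm t, List.mem_map.2 ⟨t, ht, rfl⟩, hH⟩, by simp [hg]⟩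
  · rintro ⟨l, q, S, hr, ⟨t, ht, hH⟩, hg⟩
    refine ⟨_, q, S, hr.map e (by simp [hM']) (by simp [hM']) (by simp [hM']) (by simp [hM']),
      ⟨e t, List.mem_map.2 ⟨t, ht, rfl⟩, by simpa using hH⟩, by simp [hg]⟩

end Sentence

open Turing

/-! ### Simulation of the stack machines of Mathlib -/

section Simulation

variable {K Γ Λ σ : Type}

/-- The statements that occur in the code of the labels in `A`. -/
def stmtSet (M : Λ → TM2.Stmt (fun _ : K => Γ) Λ σ) (A : Finset Λ) :
    Set (TM2.Stmt (fun _ : K => Γ) Λ σ) :=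
  {t | ∃ l ∈ A, t ∈ TM2.stmts₁ (M l)}

theorem finite_stmtSet (M : Λ → TM2.Stmt (fun _ : K => Γ) Λ σ) (A : Finset Λ) :
    (stmtSet M A).Finite :=
  (A.finite_toSet.biUnion fun l _ => (TM2.stmts₁ (M l)).finite_toSet).subset fun _ ⟨_, hl, hs⟩ =>
    Set.mem_biUnion (Finset.mem_coe.2 hl) hs

/-- The stack operation performed by the first instruction of a statement, given a guess of the
symbol that it reads. -/
def stmtOp : TM2.Stmt (fun _ : K => Γ) Λ σ → σ → Option Γ → StackOp K Γ
  | .push k f _, v, _ => .push k (f v)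
  | .peek k _ _, _, some a => .look k a false
  | .peek k _ _, _, none => .empty k
  | .pop k _ _, _, some a => .look k a true
  | .pop k _ _, _, none => .empty k
  | .load _ _, _, _ => .nop
  | .branch _ _ _, _, _ => .nop
  | .goto _, _, _ => .nop
  | .halt, _, _ => .nop

/-- The statement and the variables after the first instruction of a statement. -/
def stmtNext (M : Λ → TM2.Stmt (fun _ : K => Γ) Λ σ) :
    TM2.Stmt (fun _ : K => Γ) Λ σ → σ → Option Γ → TM2.Stmt (fun _ : K => Γ) Λ σ × σ
  | .push _ _ q, v, _ => (q, v)
  | .peek _ f q, v, o => (q, f v o)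
  | .pop _ f q, v, o => (q, f v o)
  | .load f q, v, _ => (q, f v)
  | .branch f q₁ q₂, v, _ => (cond (f v) q₁ q₂, v)
  | .goto f, v, _ => (M (f v), v)
  | .halt, v, _ => (.halt, v)

/-- The transitions of the simulating machine: two transitions that push the bottom symbols of the
input, one that pushes an input symbol, one that starts the computation, and one for each
instruction. -/
inductive SimTrans (M : Λ → TM2.Stmt (fun _ : K => Γ) Λ σ) (A : Finset Λ) : Type
  | bottom
  | second
  | input
  | go
  | run (s : stmtSet M A) (v : σ) (o : Option Γ)

/-- The states of the simulating machine. -/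
inductive SimState (K Γ Λ σ : Type) : Type
  | init
  | started
  | loading
  | run (s : TM2.Stmt (fun _ : K => Γ) Λ σ) (v : σ)

theorem finite_simTrans [Finite Γ] [Finite σ] (M : Λ → TM2.Stmt (fun _ : K => Γ) Λ σ) (A : Finset Λ) :
    Finite (SimTrans M A) := by
  have := (finite_stmtSet M A).to_subtype
  refine Finite.of_surjective
    (fun x : Fin 4 ⊕ (stmtSet M A × σ × Option Γ) => match x with
      | .inl 0 => .bottom
      | .inl 1 => .second
      | .inl 2 => .input
      | .inl 3 => .go
      | .inr (s, v, o) => .run s v o) ?_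
  rintro (_ | _ | _ | _ | ⟨s, v, o⟩)
  · exact ⟨.inl 0, rfl⟩
  · exact ⟨.inl 1, rfl⟩
  · exact ⟨.inl 2, rfl⟩
  · exact ⟨.inl 3, rfl⟩
  · exact ⟨.inr (s, v, o), rfl⟩

/-- The machine that loads a unary input above two bottom symbols on stack `k`, and then runs the
program `M` from the statement `s` with variables `v`. -/
def simMachine (M : Λ → TM2.Stmt (fun _ : K => Γ) Λ σ) (A : Finset Λ) (k : K) (b₁ b₂ b : Γ)
    (s : TM2.Stmt (fun _ : K => Γ) Λ σ) (v : σ) :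
    StackMachine (SimTrans M A) K Γ (SimState K Γ Λ σ) where
  start := .init
  src
    | .bottom => .init
    | .second => .started
    | .input => .loading
    | .go => .loading
    | .run s v _ => .run s.1 v
  dst
    | .bottom => .started
    | .second => .loading
    | .input => .loading
    | .go => .run s v
    | .run s v o => .run (stmtNext M s.1 v o).1 (stmtNext M s.1 v o).2
  op
    | .bottom => .push k b₁
    | .second => .push k b₂
    | .input => .push k b
    | .go => .nop
    | .run s v o => stmtOp s.1 v o

/-- The transitions that halt. -/
def SimTrans.IsHalt {M : Λ → TM2.Stmt (fun _ : K => Γ) Λ σ} {A : Finset Λ} :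
    SimTrans M A → Prop
  | .run s _ _ => s.1 = .halt
  | _ => False

/-- The transitions that load the input. -/
def loadTrans (M : Λ → TM2.Stmt (fun _ : K => Γ) Λ σ) (A : Finset Λ) (n : ℕ) :
    List (SimTrans M A) :=
  .bottom :: .second :: List.replicate n .input

variable {M : Λ → TM2.Stmt (fun _ : K => Γ) Λ σ} {A : Finset Λ}

theorem loadTrans_succ (n : ℕ) : loadTrans M A (n + 1) = loadTrans M A n ++ [.input] := by
  simp [loadTrans, List.replicate_succ']

theorem stmtSet_of_mem {s s' : TM2.Stmt (fun _ : K => Γ) Λ σ} (h : s' ∈ TM2.stmts₁ s)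
    (hs : s ∈ stmtSet M A) : s' ∈ stmtSet M A := by
  obtain ⟨l, hl, hs⟩ := hs
  exact ⟨l, hl, TM2.stmts₁_trans hs h⟩

/-! ### Correctness of the simulation -/

variable [DecidableEq K]

/-- The computation that starts with the statement `s` terminates. -/
def Terminates (M : Λ → TM2.Stmt (fun _ : K => Γ) Λ σ) (s : TM2.Stmt (fun _ : K => Γ) Λ σ) (v : σ)
    (S : K → List Γ) : Prop :=
  (StateTransition.eval (TM2.step M) (TM2.stepAux s v S)).Dom

theorem terminates_halt (M : Λ → TM2.Stmt (fun _ : K => Γ) Λ σ) (v : σ) (S : K → List Γ) :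
    Terminates M .halt v S := by
  rw [Terminates, Part.dom_iff_mem]
  exact ⟨_, StateTransition.mem_eval.2 ⟨.refl, rfl⟩⟩

/-- The symbol `o` is a guess of what is read, and the operation is enabled only if the guess is
right. An enabled transition therefore agrees with `TM2.stepAux`. -/
theorem terminates_of_next {M : Λ → TM2.Stmt (fun _ : K => Γ) Λ σ}
    {s : TM2.Stmt (fun _ : K => Γ) Λ σ} {v : σ} {o : Option Γ} {S S' : K → List Γ}
    (h : (stmtOp s v o).Rel S S')
    (h' : Terminates M (stmtNext M s v o).1 (stmtNext M s v o).2 S') : Terminates M s v S := by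
  cases s with
  | push k f q => cases h; exact h'
  | peek k f q =>
    cases o with
    | none =>
      obtain ⟨hk, rfl⟩ := h
      simpa [Terminates, hk, stmtNext] using h'
    | some a =>
      obtain ⟨l, hk, rfl⟩ := h
      simpa [Terminates, hk, stmtNext] using h'
  | pop k f q =>
    cases o with
    | none =>
      obtain ⟨hk, rfl⟩ := h
      -- A `pop` of `TM2` on an empty stack still writes back the tail, which is empty.
      have : update S' k [] = S' := by rw [← hk, update_eq_self]
      simpa [Terminates, hk, stmtNext, this] using h'
    | some a =>
      obtain ⟨l, hk, rfl⟩ := h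
      simpa [Terminates, hk, stmtNext] using h'
  | load f q => cases h; exact h'
  | branch f q₁ q₂ =>
    cases h
    cases hf : f v <;> simpa [Terminates, hf, stmtNext] using h'
  | goto f =>
    cases h
    -- Only `goto` crosses the boundary between two steps of `TM2`; the other instructions unfold
    -- inside `stepAux`.
    rw [Terminates, StateTransition.reaches_eval (b := TM2.stepAux (M (f v)) v S)]
    · exact h'
    · exact .single rfl
  | halt => exact terminates_halt ..

theorem StackMachine.Run.step {T Q : Type} {M : StackMachine T K Γ Q} {l : List T} {q : Q}
    {S : K → List Γ} (h : M.Run l q S) (t : T) {q' : Q} (S' : K → List Γ) (hq : M.src t = q)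
    (hq' : M.dst t = q') (hS : (M.op t).Rel S S') : M.Run (l ++ [t]) q' S' :=
  hq' ▸ h.snoc hq hS

/-- The initial stacks. -/
def initStack (k : K) (b₁ b₂ b : Γ) (n : ℕ) : K → List Γ :=
  update (fun _ => []) k (List.replicate n b ++ [b₂, b₁])

variable {k : K} {b₁ b₂ b : Γ}
  {s₀ : TM2.Stmt (fun _ : K => Γ) Λ σ} {v₀ : σ}

theorem initStack_succ (n : ℕ) : initStack k b₁ b₂ b (n + 1) =
    update (initStack k b₁ b₂ b n) k (b :: initStack k b₁ b₂ b n k) := by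
  simp [initStack, List.replicate_succ]

/-- The invariant of the runs of the simulating machine. -/
def SimInv (M : Λ → TM2.Stmt (fun _ : K => Γ) Λ σ) (A : Finset Λ) (k : K) (b₁ b₂ b : Γ)
    (s₀ : TM2.Stmt (fun _ : K => Γ) Λ σ) (v₀ : σ) (l : List (SimTrans M A)) (S : K → List Γ) :
    SimState K Γ Λ σ → Prop
  | .init => l = [] ∧ S = fun _ => []
  | .started => l = [.bottom] ∧ S = update (fun _ => []) k [b₁]
  | .loading => ∃ n, l = loadTrans M A n ∧ S = initStack k b₁ b₂ b n
  | .run s v => ∃ n l', l = loadTrans M A n ++ .go :: l' ∧ .go ∉ l' ∧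
      (Terminates M s v S → Terminates M s₀ v₀ (initStack k b₁ b₂ b n)) ∧
      ((∃ t ∈ l', t.IsHalt) → Terminates M s₀ v₀ (initStack k b₁ b₂ b n))

/-- Termination is pulled back along the run to the loaded configuration. It is recorded
conditionally for the present statement, and outright once a halting transition has fired, since the
machine may keep firing such transitions. -/
theorem simInv_of_run {l : List (SimTrans M A)} {q : SimState K Γ Λ σ} {S : K → List Γ}
    (h : (simMachine M A k b₁ b₂ b s₀ v₀).Run l q S) : SimInv M A k b₁ b₂ b s₀ v₀ l S q := by
  induction h with
  | nil => exact ⟨rfl, rfl⟩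
  | @snoc l q S t S' h hq hS ih =>
    subst hq
    cases t with
    | bottom =>
      obtain ⟨rfl, rfl⟩ := ih
      exact ⟨rfl, hS⟩
    | second =>
      obtain ⟨rfl, rfl⟩ := ih
      refine ⟨0, rfl, hS.trans ?_⟩
      simp [initStack]
    | input =>
      obtain ⟨n, rfl, rfl⟩ := ih
      exact ⟨n + 1, (loadTrans_succ n).symm, hS.trans (initStack_succ n).symm⟩
    | go =>
      obtain ⟨n, rfl, rfl⟩ := ih
      cases hS
      exact ⟨n, [], rfl, by simp, id, by simp⟩
    | run s v o =>
      obtain ⟨n, l', rfl, hgo, hT, hH⟩ := ih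
      refine ⟨n, l' ++ [.run s v o], by simp, by simp [hgo],
        fun h => hT (terminates_of_next hS h), ?_⟩
      rintro ⟨t, ht, hth⟩
      rcases List.mem_append.1 ht with ht | ht
      · exact hH ⟨t, ht, hth⟩
      · rw [List.mem_singleton.1 ht] at hth
        have hth : s.1 = .halt := hth
        exact hT (hth ▸ terminates_halt ..)

theorem run_load (n : ℕ) :
    (simMachine M A k b₁ b₂ b s₀ v₀).Run (loadTrans M A n) .loading (initStack k b₁ b₂ b n) := by
  induction n with
  | zero =>
    have h : initStack k b₁ b₂ b 0 = update (update (fun _ => []) k [b₁]) k [b₂, b₁] := by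
      simp [initStack]
    rw [h]
    have h₀ : (simMachine M A k b₁ b₂ b s₀ v₀).Run [] .init fun _ => [] := .nil
    have h₁ := h₀.step .bottom (q' := .started) (update (fun _ => []) k [b₁]) rfl rfl rfl
    refine h₁.step .second _ rfl rfl ?_
    simp [simMachine, StackOp.Rel]
  | succ n ih =>
    rw [loadTrans_succ]
    exact ih.step .input _ rfl rfl (initStack_succ n)

/-- The simulating machine can reach a halting transition from the statement `s`. -/
def CanHalt (M : Λ → TM2.Stmt (fun _ : K => Γ) Λ σ) (A : Finset Λ) (k : K) (b₁ b₂ b : Γ)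
    (s₀ : TM2.Stmt (fun _ : K => Γ) Λ σ) (v₀ : σ)
    (s : TM2.Stmt (fun _ : K => Γ) Λ σ) (v : σ) (S : K → List Γ) : Prop :=
  ∀ l, (simMachine M A k b₁ b₂ b s₀ v₀).Run l (.run s v) S →
    ∃ l' q S', (simMachine M A k b₁ b₂ b s₀ v₀).Run (l ++ l') q S' ∧ ∃ t ∈ l', t.IsHalt

theorem canHalt_of_next {s : TM2.Stmt (fun _ : K => Γ) Λ σ} (hs : s ∈ stmtSet M A) {v : σ}
    (o : Option Γ) {S S' : K → List Γ} (h : (stmtOp s v o).Rel S S')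
    (h' : CanHalt M A k b₁ b₂ b s₀ v₀ (stmtNext M s v o).1 (stmtNext M s v o).2 S') :
    CanHalt M A k b₁ b₂ b s₀ v₀ s v S := by
  intro l hl
  obtain ⟨l', q, S'', hr, t, ht, hth⟩ := h' _ (hl.step (.run ⟨s, hs⟩ v o) _ rfl rfl h)
  exact ⟨.run ⟨s, hs⟩ v o :: l', q, S'', by simpa using hr, t, List.mem_cons_of_mem _ ht, hth⟩

/-- Induction on the statement follows a single step of `TM2`, the guess `o` being read off the
actual stack. The support hypothesis keeps the targets of `goto` in `A`, so the finitely many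
transitions suffice. -/
theorem canHalt_of_stepAux (hA : ∀ l ∈ A, TM2.SupportsStmt A (M l))
    {s : TM2.Stmt (fun _ : K => Γ) Λ σ} (hs : s ∈ stmtSet M A) {v : σ} {S : K → List Γ}
    (h : ∀ l v' S', TM2.stepAux s v S = ⟨some l, v', S'⟩ → l ∈ A →
      CanHalt M A k b₁ b₂ b s₀ v₀ (M l) v' S') : CanHalt M A k b₁ b₂ b s₀ v₀ s v S := by
  induction s generalizing v S with
  | push k f q ih =>
    have hq : q ∈ stmtSet M A := stmtSet_of_mem (by simp [TM2.stmts₁, TM2.stmts₁_self]) hs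
    exact canHalt_of_next hs none rfl (ih hq h)
  | peek k f q ih =>
    have hq : q ∈ stmtSet M A := stmtSet_of_mem (by simp [TM2.stmts₁, TM2.stmts₁_self]) hs
    cases hk : S k with
    | nil => exact canHalt_of_next hs none ⟨hk, rfl⟩ (ih hq (by simpa [hk, stmtNext] using h))
    | cons a L => exact canHalt_of_next hs (some a) ⟨L, hk, rfl⟩ (ih hq (by simpa [hk, stmtNext] using h))
  | pop k f q ih =>
    have hq : q ∈ stmtSet M A := stmtSet_of_mem (by simp [TM2.stmts₁, TM2.stmts₁_self]) hs
    cases hk : S k with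
    | nil =>
      have : update S k [] = S := by rw [← hk, update_eq_self]
      exact canHalt_of_next hs none ⟨hk, rfl⟩ (ih hq (by simpa [hk, this, stmtNext] using h))
    | cons a L => exact canHalt_of_next hs (some a) ⟨L, hk, rfl⟩ (ih hq (by simpa [hk, stmtNext] using h))
  | load f q ih =>
    have hq : q ∈ stmtSet M A := stmtSet_of_mem (by simp [TM2.stmts₁, TM2.stmts₁_self]) hs
    exact canHalt_of_next hs none rfl (ih hq h)
  | branch f q₁ q₂ ih₁ ih₂ =>
    have hq₁ : q₁ ∈ stmtSet M A := stmtSet_of_mem (by simp [TM2.stmts₁, TM2.stmts₁_self]) hs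
    have hq₂ : q₂ ∈ stmtSet M A := stmtSet_of_mem (by simp [TM2.stmts₁, TM2.stmts₁_self]) hs
    refine canHalt_of_next hs none rfl ?_
    cases hf : f v with
    | true => simpa [stmtNext, hf] using ih₁ hq₁ (v := v) (S := S) (by simpa [hf] using h)
    | false => simpa [stmtNext, hf] using ih₂ hq₂ (v := v) (S := S) (by simpa [hf] using h)
  | goto f =>
    refine canHalt_of_next hs none rfl (h _ _ _ rfl ?_)
    obtain ⟨l, hl, hs⟩ := hs
    exact TM2.stmts₁_supportsStmt_mono hs (hA l hl) v
  | halt =>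
    intro l hl
    exact ⟨[.run ⟨_, hs⟩ v none], _, _, hl.step (.run ⟨_, hs⟩ v none) S rfl rfl rfl, _,
      List.mem_singleton_self _, rfl⟩

theorem canHalt_of_terminates (hA : ∀ l ∈ A, TM2.SupportsStmt A (M l))
    {s : TM2.Stmt (fun _ : K => Γ) Λ σ} (hs : s ∈ stmtSet M A) {v : σ} {S : K → List Γ}
    (h : Terminates M s v S) : CanHalt M A k b₁ b₂ b s₀ v₀ s v S := by
  rw [Terminates, Part.dom_iff_mem] at h
  obtain ⟨c', hc'⟩ := h
  obtain ⟨hr, hnone⟩ := StateTransition.mem_eval.1 hc'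
  obtain ⟨c, hc⟩ : ∃ c, c = TM2.stepAux s v S := ⟨_, rfl⟩
  rw [← hc] at hr
  clear hc'
  induction hr using Relation.ReflTransGen.head_induction_on generalizing s v S with
  -- In a final configuration no label is left, so the statement cannot have ended in a `goto`.
  | refl =>
    refine canHalt_of_stepAux hA hs fun l v' S' hl => ?_
    rw [hc, hl] at hnone
    cases hnone
  | head hstep _ ih =>
    refine canHalt_of_stepAux hA hs fun l v' S' hl hlA => ?_
    rw [hc, hl] at hstep
    exact ih ⟨l, hlA, TM2.stmts₁_self⟩ (Option.some.inj hstep).symm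

theorem simMachine_accepts_iff (hA : ∀ l ∈ A, TM2.SupportsStmt A (M l))
    (hs₀ : s₀ ∈ stmtSet M A) (n : ℕ) :
    (∃ l q S, (simMachine M A k b₁ b₂ b s₀ v₀).Run l q S ∧ (∃ t ∈ l, t.IsHalt) ∧
      l[n + 2]? = some .go) ↔ Terminates M s₀ v₀ (initStack k b₁ b₂ b n) := by
  have hno : ∀ n, SimTrans.go ∉ loadTrans M A n := by
    intro n
    simp [loadTrans, List.mem_replicate]
  have hlen : ∀ n, (loadTrans M A n).length = n + 2 := by simp [loadTrans]
  constructor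
  · rintro ⟨l, q, S, hr, ⟨t, ht, hth⟩, hg⟩
    have hgo := List.mem_of_getElem? hg
    have hinv := simInv_of_run hr
    cases q with
    | init =>
      obtain ⟨rfl, -⟩ := hinv
      cases hgo
    | started =>
      obtain ⟨rfl, -⟩ := hinv
      simp at hgo
    | loading =>
      obtain ⟨m, rfl, -⟩ := hinv
      exact (hno m hgo).elim
    | run s v =>
      obtain ⟨m, l', rfl, hl', -, hH⟩ := hinv
      -- The transition `go` occurs only once, right after the `m + 2` loading moves.
      have hmn : m = n := by
        by_contra hne
        rw [List.getElem?_append] at hg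
        split_ifs at hg with hlt
        · exact hno m (List.mem_of_getElem? hg)
        · rw [hlen] at hg hlt
          obtain ⟨j, hj⟩ : ∃ j, n + 2 - (m + 2) = j + 1 := ⟨n - m - 1, by omega⟩
          rw [hj, List.getElem?_cons_succ] at hg
          exact hl' (List.mem_of_getElem? hg)
      subst hmn
      refine hH ⟨t, ?_, hth⟩
      rcases List.mem_append.1 ht with ht | ht
      · exfalso
        simp only [loadTrans, List.mem_cons, List.mem_replicate] at ht
        rcases ht with rfl | rfl | ⟨-, rfl⟩ <;> exact hth
      · rcases List.mem_cons.1 ht with rfl | ht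
        · exact hth.elim
        · exact ht
  · intro h
    obtain ⟨l', q, S, hr, t, ht, hth⟩ := canHalt_of_terminates hA hs₀ h _
      ((run_load n).step .go _ rfl rfl rfl)
    refine ⟨_, q, S, hr, ⟨t, List.mem_append_right _ ht, hth⟩, ?_⟩
    rw [List.append_assoc, List.getElem?_append_right (hlen n).le, hlen]
    simp

end Simulation

open ToPartrec

/-! ### Undecidability -/

/-- Program that moves one symbol of a unary number, terminated by `1`, to an accumulator. -/
def countStep : Code :=
  .comp (.case (.cons (.comp .succ .zero) (.cons .succ (.comp .tail .tail))) (.cons .zero .tail))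
    (.cons (.comp .head .tail) .id)

theorem eval_comp_of_eq {f g : Code} {v w : List ℕ} (h : g.eval v = Part.some w) :
    (f.comp g).eval v = f.eval w := by
  rw [Code.comp_eval]
  exact (congrArg (fun x => Part.bind x f.eval) h).trans (Part.bind_some _ _)

theorem eval_cons_of_eq {f g : Code} {v w w' : List ℕ} (h : f.eval v = Part.some w)
    (h' : g.eval v = Part.some w') : (f.cons g).eval v = Part.some (w.headI :: w') := by
  rw [Code.cons_eval]
  exact (congrArg₂ (fun (x y : Part (List ℕ)) =>
    x.bind fun n => y.bind fun ns => Part.some (n.headI :: ns)) h h').trans (by simp)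

theorem eval_countStep (a b : ℕ) (l : List ℕ) : countStep.eval (a :: b :: l) =
    (Code.case (.cons (.comp .succ .zero) (.cons .succ (.comp .tail .tail)))
      (.cons .zero .tail)).eval (b :: a :: b :: l) := by
  refine eval_comp_of_eq (eval_cons_of_eq (w := [b]) ?_ (Code.id_eval (a :: b :: l)))
  rw [eval_comp_of_eq (w := b :: l) (by simp)]
  exact Code.head_eval _

theorem countStep_zero (a : ℕ) (l : List ℕ) :
    countStep.eval (a :: 0 :: l) = Part.some (1 :: (a + 1) :: l) := by
  rw [eval_countStep, Code.case_eval]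
  refine eval_cons_of_eq (w := [1]) ?_ (eval_cons_of_eq (w := [a + 1]) (by simp) ?_)
  · rw [eval_comp_of_eq (w := [0]) (by simp)]
    simp
  · rw [eval_comp_of_eq (w := 0 :: l) (by simp)]
    simp

theorem countStep_one (a : ℕ) (l : List ℕ) :
    countStep.eval (a :: 1 :: l) = Part.some (0 :: a :: 1 :: l) := by
  rw [eval_countStep, Code.case_eval]
  exact eval_cons_of_eq (w := [0]) (Code.zero_eval _) (by simp)

/-- The head of the output of `countStep` drives the loop: each `0` is absorbed into the accumulator
and the loop continues (`Sum.inr`), while the terminator `1` stops it (`Sum.inl`). -/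
theorem fix_countStep (n a : ℕ) :
    countStep.fix.eval (a :: (List.replicate n 0 ++ [1])) = Part.some [a + n, 1] := by
  rw [Code.fix_eval]
  obtain ⟨F, hF⟩ : ∃ F : List ℕ →. List ℕ ⊕ List ℕ, F = fun v => (countStep.eval v).map fun v =>
    if v.headI = 0 then Sum.inl v.tail else Sum.inr v.tail := ⟨_, rfl⟩
  have h₀ : ∀ a l, Sum.inr ((a + 1) :: l) ∈ F (a :: 0 :: l) := fun a l => by
    rw [hF]
    exact (Part.mem_map_iff _).2 ⟨_, Part.eq_some_iff.1 (countStep_zero a l), rfl⟩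
  have h₁ : ∀ a l, Sum.inl (a :: 1 :: l) ∈ F (a :: 1 :: l) := fun a l => by
    rw [hF]
    exact (Part.mem_map_iff _).2 ⟨_, Part.eq_some_iff.1 (countStep_one a l), rfl⟩
  rw [← hF]
  induction n generalizing a with
  | zero => exact Part.eq_some_iff.2 (PFun.fix_stop (h₁ a []))
  | succ n ih =>
    rw [List.replicate_succ, List.cons_append, PFun.fix_fwd_eq (h₀ a _), ih, Nat.add_right_comm,
      Nat.add_assoc]

/-- Program that computes a unary number terminated by `1`. -/
def countUnary : Code := .comp .head countStep.fix

/-- The first `0` of the list serves as initial accumulator, so only `n` zeros are counted. -/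
theorem countUnary_eval (n : ℕ) :
    countUnary.eval (List.replicate (n + 1) 0 ++ [1]) = Part.some [n] := by
  rw [List.replicate_succ, List.cons_append, countUnary, eval_comp_of_eq (fix_countStep n 0)]
  simp

theorem exists_code_unary {f : ℕ →. ℕ} (hf : Partrec f) : ∃ c : Code, ∀ n,
    (c.eval (List.replicate (n + 1) 0 ++ [1])).Dom ↔ (f n).Dom := by
  obtain ⟨c, hc⟩ := Code.exists_code (Nat.Partrec'.part_iff₁.2 hf)
  refine ⟨c.comp countUnary, fun n => ?_⟩
  rw [eval_comp_of_eq (countUnary_eval n)]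
  exact iff_of_eq (congrArg Part.Dom (hc (n ::ᵥ List.Vector.nil)))

/-- A `0` is encoded by the separator alone, so loading a unary number repeats one push; the
terminator `1` supplies the two bottom symbols. -/
theorem trList_unary (n : ℕ) : PartrecToTM2.trList (List.replicate n 0 ++ [1]) =
    List.replicate n .cons ++ [.bit1, .cons] := by
  induction n with
  | zero => rfl
  | succ n ih => simp [List.replicate_succ, ih]

/-- The stack machine of Mathlib that evaluates programs. -/
def codeMachine : PartrecToTM2.Λ' →
    TM2.Stmt (fun _ : PartrecToTM2.K' => PartrecToTM2.Γ') PartrecToTM2.Λ'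
      (Option PartrecToTM2.Γ') := PartrecToTM2.tr

theorem terminates_iff (c : Code) (n : ℕ) :
    Terminates codeMachine (codeMachine (PartrecToTM2.trNormal c .halt)) none
      (initStack .main .cons .bit1 .cons n) ↔ (c.eval (List.replicate n 0 ++ [1])).Dom := by
  have h : initStack PartrecToTM2.K'.main .cons .bit1 .cons n =
      PartrecToTM2.K'.elim (PartrecToTM2.trList (List.replicate n 0 ++ [1])) [] [] [] := by
    rw [trList_unary]
    funext k
    cases k <;> rfl
  -- One step leads from the initial configuration to the result of `stepAux` on the first
  -- statement, from which `Terminates` evaluates.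
  have h' : StateTransition.eval (TM2.step codeMachine)
      (PartrecToTM2.init c (List.replicate n 0 ++ [1])) = StateTransition.eval _ (TM2.stepAux
        (codeMachine (PartrecToTM2.trNormal c .halt)) none _) :=
    StateTransition.reaches_eval (.single rfl)
  rw [Terminates, h]
  exact iff_of_eq (congrArg Part.Dom (h'.symm.trans (PartrecToTM2.tr_eval c _)))

/-- A family of inputs, computable from a number `n`, of which the positive instances are the `n` in
the domain of a given partial recursive function. -/
theorem exists_input_of_partrec {f : ℕ →. ℕ} (hf : Partrec f) :
    ∃ I : ℕ → Input, (Computable fun n => (I n).code) ∧ ∀ n, (I n).PartSynth ↔ (f n).Dom := by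
  obtain ⟨c, hc⟩ := exists_code_unary hf
  obtain ⟨A, hmem, hA⟩ : ∃ A : Finset PartrecToTM2.Λ', PartrecToTM2.trNormal c .halt ∈ A ∧
      ∀ l ∈ A, TM2.SupportsStmt A (codeMachine l) := ⟨_, PartrecToTM2.tr_supports c .halt⟩
  have := finite_simTrans codeMachine A
  obtain ⟨I, hI, h⟩ := exists_input
    (simMachine codeMachine A .main .cons .bit1 .cons
      (codeMachine (PartrecToTM2.trNormal c .halt)) none) SimTrans.IsHalt .go
  -- The word for `n` has `n + 1` zeros, one being the accumulator, and two bottom symbols are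
  -- pushed first: this is the time of `go`.
  refine ⟨fun n => I (n + 1 + 2), hI.comp (Primrec.nat_add.comp .id (.const 3)).to_comp,
    fun n => ?_⟩
  rw [h, simMachine_accepts_iff hA ⟨_, hmem, TM2.stmts₁_self⟩, terminates_iff, hc]

end DataSynth

/-- The synthesis problem for `FO²[∼,<]` with partitioned processes is undecidable: no computable
predicate on (numbers of) inputs decides which inputs are positive instances. -/
theorem mainTheorem2 :
    ¬ ∃ D : ℕ → Prop, ComputablePred D ∧ ∀ I : DataSynth.Input, D I.code ↔ I.PartSynth := by
  rintro ⟨D, hD, h⟩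
  -- The universal function on argument `0`: its domain is the halting set, to which the reduction
  -- is applied.
  have hf : Partrec fun n => (Denumerable.ofNat Nat.Partrec.Code n).eval 0 :=
    Nat.Partrec.Code.eval_part.comp (Computable.ofNat _) (Computable.const 0)
  obtain ⟨I, hI, hI'⟩ := DataSynth.exists_input_of_partrec hf
  refine ComputablePred.halting_problem 0 (ComputablePred.computable_of_manyOneReducible
    ⟨fun c => (I (Encodable.encode c)).code, hI.comp Computable.encode, fun c => ?_⟩ hD)
  rw [h, hI', Denumerable.ofNat_encode]
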